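/- **Setting.** Let $\mathcal X$ be a finite set, $\mathcal H_B$ a finite-dimensional Hilbert space, and $(\rho_x)_{x\in\mathcal X}$ density operators on $\mathcal H_B$, defining the classical-quantum channel $\mathcal N(\cdot)=\sum_x\langle x|\cdot|x\rangle\,\rho_x$. Let $D(\rho\|\sigma)=\operatorname{Tr}[\rho(\log\rho-\log\sigma)]$ if $\operatorname{supp}\rho\subseteq\operatorname{supp}\sigma$ and $D(\rho\|\sigma)=+\infty$ otherwise. The umlaut information of a bipartite state is $U(A;B)_\rho=\min_{\sigma_B}D(\rho_A\otimes\sigma_B\|\rho_{AB})$, the minimum being over density operators $\sigma_B$, and that of a channel $\mathcal N_{A\to B}$ is $U(\mathcal N)=\sup_{\Psi_{A'A}}U(A';B)_{(\mathrm{Id}\otimes\mathcal N)(\Psi)}$, the supremum being over all states $\Psi$ of $A'A$ with $A'$ a copy of $A$. For a probability distribution $P$ on $\mathcal X$ put $U_P:=U(X';B)_{\rho^{(\mathcal N)}}$, where $$\rho^{(\mathcal N)}_{X'B}=(\mathrm{Id}\otimes\mathcal N)\big((P^{1/2}\otimes\mathbb 1)\Phi(P^{1/2}\otimes\mathbb 1)\big),\qquad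 P=\sum_xP(x)|x\rangle\langle x|,\quad \Phi=\sum_{x,y}|xx\rangle\langle yy| .$$ For $k\ge1$ and $q\in\mathbb R^k$ with $\sum_iq_i=1$ let $$\ell_{k,q}(\mathcal N,P)=\sum_{x_1,\dots,x_k\in\mathcal X}P(x_1)\cdots P(x_k)\Big(-\log\operatorname{Tr}\exp\Big(\sum_{i=1}^kq_i\log\rho_{x_i}\Big)\Big)\in[-\infty,+\infty].$$ Here $\log 0=-\infty$, $0\cdot(\pm\infty)=0$, $\exp(-\infty)=0$: the exponential lives on $V=\bigcap_{i:q_i>0}\operatorname{supp}\rho_{x_i}$, where the exponent is the compression to $V$ of $\sum_iq_i\log\rho_{x_i}$ (so the summand is $+\infty$ if $V=\{0\}$); if $V\not\subseteq\operatorname{supp}\rho_{x_i}$ for some $i$ with $q_i<0$, the trace is $+\infty$ and the summand $-\infty$. A sum that contains both $+\infty$ and $-\infty$ is read as $-\infty$. **Statement.** (1) For all $k\ge1$, all $q\in\mathbb R^k$ with $\sum_iq_i=1$ and all $P$, $$U_P\ \ge\ \ell_{k,q}(\mathcal N,P),\qquad\text{and hence}\qquad U(\mathcal N)\ \ge\ \sup_{P}\ell_{k,q}(\mathcal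 N,P).$$ (2) Suppose moreover that all $\rho_x$, $x\in\mathcal X$, have the same support, and let $u_k=(1/k,\dots,1/k)$. Then for every $P$ $$U_P=\lim_{k\to\infty}\ell_{k,u_k}(\mathcal N,P),\qquad\text{and}\qquad U(\mathcal N)=\sup_{P}\lim_{k\to\infty}\ell_{k,u_k}(\mathcal N,P).$$ (3) Under the assumption of (2), for every $P$ and every $k\ge1$ both $U_P$ and $\ell_{k,u_k}(\mathcal N,P)$ are finite and $$U_P-\ell_{k,u_k}(\mathcal N,P)\ \le\ \begin{cases}\dfrac{3}{k^{1/3}}\Big(\tfrac12\,U_P^{1/2}\,\lambda\Big)^{2/3}&\text{if }P^\ast<P_{\min},\\[2ex]\dfrac{1}{kP_{\min}^2}\,U_P+P_{\min}\,\lambda&\text{if }P^\ast\ge P_{\min},\end{cases}$$ where $\lambda=\lambda^{\rm fin}_{\max}(R_P)$ is the largest finite eigenvalue of $R_P=-\sum_{x\in\operatorname{supp}P}\log\rho_x$ (its largest eigenvalue on the common support of the $\rho_x$), $P_{\min}=\min\{P(x):P(x)>0\}$ and $P^\ast=k^{-1/3}\,(2U_P/\lambda)^{1/3}$, with $P^\ast:=0$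 if $\lambda=0$ (then $U_P=0$). -/

import Mathlib

open Filter Topology
open scoped Matrix Kronecker ENNReal ComplexOrder

namespace Umlaut

noncomputable section

/-- Density matrices: positive semidefinite with unit trace. -/
def IsDensity {n : Type*} [Fintype n] (M : Matrix n n ℂ) : Prop :=
  M.PosSemidef ∧ M.trace = 1

/-- The support of a Hermitian matrix, that is, its range. -/
def supp {n : Type*} [Fintype n] [DecidableEq n] (M : Matrix n n ℂ) :
    Submodule ℂ (EuclideanSpace ℂ n) :=
  LinearMap.range (Matrix.toEuclideanLin M)

/-- The matrix of the orthogonal projection onto a subspace. -/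
def projMatrix {n : Type*} [Fintype n] [DecidableEq n]
    (V : Submodule ℂ (EuclideanSpace ℂ n)) : Matrix n n ℂ :=
  Matrix.toEuclideanLin.symm (V.starProjection : EuclideanSpace ℂ n →ₗ[ℂ] EuclideanSpace ℂ n)

/-- The logarithm of a positive semidefinite matrix on its support, extended by `0` on its kernel.
Wherever it is used below, the infinite part `log 0 = -∞` is treated separately. -/
def mlog {n : Type*} [Fintype n] [DecidableEq n] (M : Matrix n n ℂ) : Matrix n n ℂ :=
  cfc Real.log M

open Classical in
/-- Umegaki relative entropy `D(ρ‖σ)`, with value `+∞` unless `supp ρ ⊆ supp σ`. -/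
def relEntropy {n : Type*} [Fintype n] [DecidableEq n] (ρ σ : Matrix n n ℂ) : EReal :=
  if supp ρ ≤ supp σ then (((ρ * (mlog ρ - mlog σ)).trace.re : ℝ) : EReal) else ⊤

/-- The marginal on the first system (partial trace over the second one). -/
def marginalFst {a b : Type*} [Fintype b] (M : Matrix (a × b) (a × b) ℂ) : Matrix a a ℂ :=
  Matrix.of fun i j => ∑ s, M (i, s) (j, s)

/-- Umlaut information `U(A;B)_ρ = min_σ D(ρ_A ⊗ σ ‖ ρ)` of a bipartite state. -/
def umlaut {a b : Type*} [Fintype a] [DecidableEq a] [Fintype b] [DecidableEq b]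
    (ρ : Matrix (a × b) (a × b) ℂ) : EReal :=
  ⨅ (σ : Matrix b b ℂ) (_ : IsDensity σ), relEntropy (marginalFst ρ ⊗ₖ σ) ρ

/-- The map `Id ⊗ N` on bipartite matrices: `N` is applied to each block. -/
def idTensor (r : Type*) {a b : Type*} (N : Matrix a a ℂ →ₗ[ℂ] Matrix b b ℂ)
    (M : Matrix (r × a) (r × a) ℂ) : Matrix (r × b) (r × b) ℂ :=
  Matrix.of fun p s => N (Matrix.of fun i j => M (p.1, i) (s.1, j)) p.2 s.2

/-- Umlaut information of a channel `N`: the supremum of `U(A';B)` on `(Id ⊗ N)(Ψ)` over all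
states `Ψ` of `A'A`, where `A'` is a copy of `A`. -/
def channelUmlaut {a b : Type*} [Fintype a] [DecidableEq a] [Fintype b] [DecidableEq b]
    (N : Matrix a a ℂ →ₗ[ℂ] Matrix b b ℂ) : EReal :=
  ⨆ (Ψ : Matrix (a × a) (a × a) ℂ) (_ : IsDensity Ψ), umlaut (idTensor a N Ψ)

/-- The classical-quantum channel `M ↦ ∑ x, ⟨x|M|x⟩ ρ_x`. -/
def cqChannel {X B : Type*} [Fintype X] (ρ : X → Matrix B B ℂ) :
    Matrix X X ℂ →ₗ[ℂ] Matrix B B ℂ where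
  toFun M := ∑ x, M x x • ρ x
  map_add' M M' := by simp [add_smul, Finset.sum_add_distrib]
  map_smul' c M := by simp [mul_smul, Finset.smul_sum]

/-- The unnormalised maximally entangled state `Φ = ∑ x y, |xx⟩⟨yy|`. -/
def maxEntangled (X : Type*) [DecidableEq X] : Matrix (X × X) (X × X) ℂ :=
  Matrix.of fun p s => if p.1 = p.2 ∧ s.1 = s.2 then 1 else 0

/-- `(Id ⊗ N)((P^{1/2} ⊗ 1) Φ (P^{1/2} ⊗ 1))` for the diagonal matrix `P` of a distribution. -/
def outputState {X B : Type*} [Fintype X] [DecidableEq X]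
    (N : Matrix X X ℂ →ₗ[ℂ] Matrix B B ℂ) (P : X → ℝ) : Matrix (X × B) (X × B) ℂ :=
  idTensor X N
    ((Matrix.diagonal (fun x => ((√(P x) : ℝ) : ℂ)) ⊗ₖ (1 : Matrix X X ℂ)) * maxEntangled X *
      (Matrix.diagonal (fun x => ((√(P x) : ℝ) : ℂ)) ⊗ₖ (1 : Matrix X X ℂ)))

/-- The intersection of the supports of the matrices that carry a positive weight. -/
def posSupp {ι n : Type*} [Fintype n] [DecidableEq n] (q : ι → ℝ) (τ : ι → Matrix n n ℂ) :
    Submodule ℂ (EuclideanSpace ℂ n) :=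
  ⨅ (i : ι) (_ : 0 < q i), supp (τ i)

open Classical in
/-- `Tr exp (∑ i, q i • log (τ i))` in `[0, ∞]`, with `log 0 = -∞`, `0 · (-∞) = 0`,
`exp (-∞) = 0` and `exp (+∞) = +∞`. The exponent is `-∞` off `V = posSupp q τ`, so that the
exponential lives on `V`; it is `+∞` in some direction of `V` if `V` is not contained in the
support of some `τ i` of negative weight. Otherwise the exponent is the compression to `V` of the
weighted sum of logarithms, and the trace of its exponential is taken over `V`. -/
def trExpLog {ι n : Type*} [Fintype ι] [Fintype n] [DecidableEq n]
    (q : ι → ℝ) (τ : ι → Matrix n n ℂ) : ℝ≥0∞ :=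
  if ∀ i, q i < 0 → posSupp q τ ≤ supp (τ i) then
    ENNReal.ofReal (Matrix.trace (projMatrix (posSupp q τ) *
      NormedSpace.exp (projMatrix (posSupp q τ) * (∑ i, (q i : ℂ) • mlog (τ i)) *
        projMatrix (posSupp q τ)))).re
  else ⊤

/-- The lower umlaut information `ℓ_{k,q}` of the classical-quantum channel `x ↦ ρ x` with input
distribution `P`; here `-log 0 = +∞` and `-log ∞ = -∞`. -/
def lowerUmlaut {X B : Type*} [Fintype X] [Fintype B] [DecidableEq B]
    (ρ : X → Matrix B B ℂ) (P : X → ℝ) {k : ℕ} (q : Fin k → ℝ) : EReal :=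
  ∑ x : Fin k → X, ((∏ i, P (x i) : ℝ) : EReal) * (-ENNReal.log (trExpLog q (fun i => ρ (x i))))

/-- The uniform weight vector `u_k = (1/k, …, 1/k)`. -/
def uniformWeight (k : ℕ) : Fin k → ℝ := fun _ => 1 / (k : ℝ)

/-- The subspace on which `R_P = -∑ x ∈ supp P, log ρ_x` is finite. -/
def finSupp {X B : Type*} [Fintype B] [DecidableEq B]
    (ρ : X → Matrix B B ℂ) (P : X → ℝ) : Submodule ℂ (EuclideanSpace ℂ B) :=
  ⨅ (x : X) (_ : P x ≠ 0), supp (ρ x)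

open Classical in
/-- The finite part of `R_P = -∑ x ∈ supp P, log ρ_x`. -/
def finR {X B : Type*} [Fintype X] [Fintype B] [DecidableEq B]
    (ρ : X → Matrix B B ℂ) (P : X → ℝ) : Matrix B B ℂ :=
  projMatrix (finSupp ρ P) * (-∑ x with P x ≠ 0, mlog (ρ x)) * projMatrix (finSupp ρ P)

/-- The largest finite eigenvalue of `R_P`. -/
def lamFin {X B : Type*} [Fintype X] [Fintype B] [DecidableEq B]
    (ρ : X → Matrix B B ℂ) (P : X → ℝ) : ℝ :=
  sSup {μ : ℝ | ∃ v ∈ finSupp ρ P, v ≠ 0 ∧ Matrix.toEuclideanLin (finR ρ P) v = (μ : ℂ) • v}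

/-- The smallest nonzero probability. -/
def pMin {X : Type*} (P : X → ℝ) : ℝ := sInf {p : ℝ | ∃ x, P x ≠ 0 ∧ p = P x}

/-- `P* = k^{-1/3} (2u/lam)^{1/3}`. -/
def pStar (k : ℕ) (u lam : ℝ) : ℝ :=
  1 / (k : ℝ) ^ (1 / 3 : ℝ) * (2 * u / lam) ^ (1 / 3 : ℝ)

/-- The right-hand side of the quantitative estimate. -/
def rateBound (k : ℕ) (u lam pmin : ℝ) : ℝ :=
  if pStar k u lam < pmin then
    3 / (k : ℝ) ^ (1 / 3 : ℝ) * (1 / 2 * u ^ (1 / 2 : ℝ) * lam) ^ (2 / 3 : ℝ)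
  else
    1 / ((k : ℝ) * pmin ^ 2) * u + pmin * lam

end

end Umlaut

set_option linter.unusedSectionVars false

namespace Umlaut

/-! ### Spectral coordinates -/

/-! The output state is block diagonal with blocks `P x • ρ x`, so for a density matrix `σ`
supported in every `supp (ρ x)` with `P x ≠ 0` the quantity minimized in `U_P` is `Tr σ log σ - ∑
P(x) Tr σ log ρ_x`; for every other `σ` it is `+∞`.

Lower bound: the Gibbs variational inequality `-log Tr exp H ≤ Tr σ log σ - Tr σ H`
(`neg_log_trace_expOn_le`, from Klein's inequality) is applied to `H = ∑ q_i log ρ_{x_i}` and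
averaged over independent symbols `x_i ~ P`. Since `∑ q_i = 1`, the right-hand side averages to
exactly the quantity above (`lowerUmlaut_le_relEntropy`).

Rate: with a common support, Gibbs states attain equality, so the summand of a tuple is `∑ T(y)
D(γ‖ρ_y)`, with `T` the empirical distribution of the tuple and `γ` its Gibbs state. It is
nonnegative. If `T ≥ P - c` pointwise, it is at least `U_P - c λ`, because `-Tr γ log ρ_y ≥ 0` and
`Tr γ R_P ≤ λ`. By Chebyshev the remaining tuples have probability at most `1/(k c²)`. Hence `U_P -
ℓ ≤ U_P/(k c²) + c λ` for every `c > 0` (`exists_lowerUmlaut_eq_coe`). Taking `c = k^{-1/3}` gives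
convergence; `c = P*` or `c = P_min` gives the stated rate (`le_rateBound`).

Channel: `U(N) = sup_P U_P` (`channelUmlaut_eq_iSup`). A general input `Ψ` yields `∑ Ψ_x ⊗ ρ_x`, and
joint convexity bounds its relative entropy by `∑ Tr Ψ_x · D(σ‖ρ_x)`, the objective of `U_P` for
`P(x) = Tr Ψ_x`. Joint convexity (`relEntropy_trace_sum_le`) is obtained by writing the relative
entropy through a primitive in `s` whose derivative is a maximum of functionals linear in both
arguments. -/

/-- The unitary matrix `U` diagonalizes `A`, with the real eigenvalues `a`. -/
structure Diagonalizes {n : Type*} [Fintype n] [DecidableEq n]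
    (U A : Matrix n n ℂ) (a : n → ℝ) : Prop where
  left : Uᴴ * U = 1
  right : U * Uᴴ = 1
  eq : A = U * Matrix.diagonal (fun i => (a i : ℂ)) * Uᴴ

/-- The squared moduli of the overlaps of the columns of `U` with those of `V`. -/
noncomputable def overlap {n : Type*} [Fintype n] (U V : Matrix n n ℂ) (i j : n) : ℝ :=
  Complex.normSq ((Uᴴ * V) i j)

section Spectral

variable {n : Type*} [Fintype n] [DecidableEq n] {A ρ τ U V : Matrix n n ℂ} {a p t : n → ℝ}

theorem overlap_nonneg (U V : Matrix n n ℂ) (i j : n) : 0 ≤ overlap U V i j :=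
  Complex.normSq_nonneg _

theorem exists_diagonalizes (hA : A.IsHermitian) : ∃ U, Diagonalizes U A hA.eigenvalues := by
  refine ⟨hA.eigenvectorUnitary, ?_, ?_, ?_⟩
  · exact Unitary.coe_star_mul_self hA.eigenvectorUnitary
  · exact Unitary.coe_mul_star_self hA.eigenvectorUnitary
  · exact hA.spectral_theorem

theorem exists_diagonalizes_nonneg (hA : A.PosSemidef) :
    ∃ U a, Diagonalizes U A a ∧ ∀ i, 0 ≤ a i := by
  obtain ⟨U, hU⟩ := exists_diagonalizes hA.1
  exact ⟨U, _, hU, hA.eigenvalues_nonneg⟩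

namespace Diagonalizes

/-- The unitary `Uᴴ * V` intertwines the two diagonal matrices, so its nonzero entries join equal
eigenvalues only, and it also intertwines their images under `f`. This makes `mlog` computable in
any eigenbasis. -/
theorem map_eq_of_diagonalizes {b : n → ℝ} (hU : Diagonalizes U A a) (hV : Diagonalizes V A b)
    (f : ℝ → ℝ) :
    U * Matrix.diagonal (fun i => (f (a i) : ℂ)) * Uᴴ =
      V * Matrix.diagonal (fun i => (f (b i) : ℂ)) * Vᴴ := by
  have h1 : Matrix.diagonal (fun i => (a i : ℂ)) * (Uᴴ * V) =
      (Uᴴ * V) * Matrix.diagonal (fun i => (b i : ℂ)) := by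
    calc _ = (Uᴴ * U) * Matrix.diagonal (fun i => (a i : ℂ)) * (Uᴴ * V) := by
          rw [hU.left, one_mul]
      _ = Uᴴ * A * V := by rw [hU.eq]; simp only [mul_assoc]
      _ = Uᴴ * V * Matrix.diagonal (fun i => (b i : ℂ)) * (Vᴴ * V) := by
          rw [hV.eq]; simp only [mul_assoc]
      _ = _ := by rw [hV.left, mul_one]
  have h2 : Matrix.diagonal (fun i => (f (a i) : ℂ)) * (Uᴴ * V) =
      (Uᴴ * V) * Matrix.diagonal (fun i => (f (b i) : ℂ)) := by
    ext i j
    have h := congrFun (congrFun h1 i) j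
    rw [Matrix.diagonal_mul, Matrix.mul_diagonal] at h ⊢
    by_cases hc : (Uᴴ * V) i j = 0
    · simp [hc]
    · have : (a i : ℂ) = b j := by
        apply mul_right_cancel₀ hc; rw [h, mul_comm]
      rw [Complex.ofReal_inj] at this
      rw [this, mul_comm]
  calc _ = U * (Matrix.diagonal (fun i => (f (a i) : ℂ)) * (Uᴴ * V)) * Vᴴ := by
        simp only [mul_assoc, hV.right, mul_one]
    _ = (U * Uᴴ) * V * Matrix.diagonal (fun i => (f (b i) : ℂ)) * Vᴴ := by
        rw [h2]; simp only [mul_assoc]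
    _ = _ := by rw [hU.right, one_mul]

theorem isHermitian (h : Diagonalizes U A a) : A.IsHermitian := by
  rw [Matrix.IsHermitian, h.eq]
  simp only [Matrix.conjTranspose_mul, Matrix.conjTranspose_conjTranspose,
    Matrix.diagonal_conjTranspose, mul_assoc]
  congr 3
  ext i
  simp

theorem posSemidef (h : Diagonalizes U A a) (ha : ∀ i, 0 ≤ a i) : A.PosSemidef := by
  rw [h.eq]
  refine Matrix.PosSemidef.mul_mul_conjTranspose_same ?_ U
  exact Matrix.PosSemidef.diagonal fun i => by simpa using ha i

theorem mlog (h : Diagonalizes U A a) :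
    Diagonalizes U (mlog A) (fun i => Real.log (a i)) := by
  refine ⟨h.left, h.right, ?_⟩
  obtain ⟨V, hV⟩ := exists_diagonalizes h.isHermitian
  rw [map_eq_of_diagonalizes h ⟨hV.left, hV.right, hV.eq⟩ Real.log, Umlaut.mlog,
    h.isHermitian.cfc_eq,
    map_eq_of_diagonalizes hV (V := h.isHermitian.eigenvectorUnitary)
      (b := h.isHermitian.eigenvalues) ?_ Real.log]
  · rfl
  · refine ⟨?_, ?_, h.isHermitian.spectral_theorem⟩
    · exact Unitary.coe_star_mul_self h.isHermitian.eigenvectorUnitary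
    · exact Unitary.coe_mul_star_self h.isHermitian.eigenvectorUnitary

theorem smul (h : Diagonalizes U A a) (r : ℝ) :
    Diagonalizes U ((r : ℂ) • A) (fun i => r * a i) := by
  refine ⟨h.left, h.right, ?_⟩
  rw [h.eq, ← Matrix.smul_mul, ← Matrix.mul_smul]
  congr 2
  ext i j
  by_cases hij : i = j <;> simp [hij]

theorem trace (h : Diagonalizes U A a) : A.trace = ∑ i, (a i : ℂ) := by
  rw [h.eq, Matrix.trace_mul_comm, ← mul_assoc, h.left, one_mul, Matrix.trace_diagonal]

theorem trace_re (h : Diagonalizes U A a) : A.trace.re = ∑ i, a i := by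
  rw [h.trace, Complex.re_sum]; simp

theorem mul_self (h : Diagonalizes U A a) {b : n → ℝ} {A' : Matrix n n ℂ}
    (h' : Diagonalizes U A' b) : Diagonalizes U (A * A') (fun i => a i * b i) := by
  refine ⟨h.left, h.right, ?_⟩
  rw [h.eq, h'.eq]
  calc _ = U * Matrix.diagonal (fun i => (a i : ℂ)) * (Uᴴ * U) *
        Matrix.diagonal (fun i => (b i : ℂ)) * Uᴴ := by simp only [mul_assoc]
    _ = _ := by
      rw [h.left, mul_one, mul_assoc U, Matrix.diagonal_mul_diagonal]
      simp

/-- Together with `sum_overlap_right`: overlaps of two orthonormal bases are doubly stochastic,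
which reduces trace inequalities to scalar ones. -/
theorem sum_overlap_left (hU : U * Uᴴ = 1) (hV : Vᴴ * V = 1) (j : n) :
    ∑ i, overlap U V i j = 1 := by
  have h : (Uᴴ * V)ᴴ * (Uᴴ * V) = 1 := by
    rw [Matrix.conjTranspose_mul, Matrix.conjTranspose_conjTranspose, mul_assoc, ← mul_assoc U,
      hU, one_mul, hV]
  have h' := congrFun (congrFun h j) j
  simp only [Matrix.mul_apply (M := (Uᴴ * V)ᴴ), Matrix.conjTranspose_apply, Matrix.one_apply_eq,
    RCLike.star_def, ← Complex.normSq_eq_conj_mul_self] at h'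
  exact_mod_cast h'

theorem sum_overlap_right (hU : Uᴴ * U = 1) (hV : V * Vᴴ = 1) (i : n) :
    ∑ j, overlap U V i j = 1 := by
  have h : (Uᴴ * V) * (Uᴴ * V)ᴴ = 1 := by
    rw [Matrix.conjTranspose_mul, Matrix.conjTranspose_conjTranspose, mul_assoc, ← mul_assoc V,
      hV, one_mul, hU]
  have h' := congrFun (congrFun h i) i
  simp only [Matrix.mul_apply (N := (Uᴴ * V)ᴴ), Matrix.conjTranspose_apply, Matrix.one_apply_eq,
    RCLike.star_def, Complex.mul_conj] at h'
  exact_mod_cast h'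

theorem trace_mul_re (hU : Diagonalizes U ρ p) (hV : Diagonalizes V τ t) :
    (ρ * τ).trace.re = ∑ i, ∑ j, overlap U V i j * (p i * t j) := by
  have h : (ρ * τ).trace = (Matrix.diagonal (fun i => (p i : ℂ)) * (Uᴴ * V) *
      (Matrix.diagonal (fun i => (t i : ℂ)) * (Uᴴ * V)ᴴ)).trace := by
    rw [hU.eq, hV.eq, Matrix.conjTranspose_mul, Matrix.conjTranspose_conjTranspose]
    rw [mul_assoc U, mul_assoc U, Matrix.trace_mul_comm U]
    simp only [mul_assoc]
  rw [h, Matrix.trace, Complex.re_sum]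
  refine Finset.sum_congr rfl fun i _ => ?_
  rw [Matrix.diag_apply, Matrix.mul_apply, Complex.re_sum]
  refine Finset.sum_congr rfl fun j _ => ?_
  rw [Matrix.diagonal_mul, Matrix.diagonal_mul, Matrix.conjTranspose_apply, overlap]
  have : (p i : ℂ) * (Uᴴ * V) i j * ((t j : ℂ) * star ((Uᴴ * V) i j)) =
      ((Complex.normSq ((Uᴴ * V) i j) * (p i * t j) : ℝ) : ℂ) := by
    push_cast
    rw [Complex.normSq_eq_conj_mul_self, RCLike.star_def]
    ring
  rw [this, Complex.ofReal_re]

theorem trace_mul_self_re (h : Diagonalizes U A a) {b : n → ℝ} {A' : Matrix n n ℂ}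
    (h' : Diagonalizes U A' b) : (A * A').trace.re = ∑ i, a i * b i :=
  (h.mul_self h').trace_re

theorem trace_relEntropy (hU : Diagonalizes U ρ p) (hV : Diagonalizes V τ t) :
    (ρ * (Umlaut.mlog ρ - Umlaut.mlog τ)).trace.re =
      ∑ i, ∑ j, overlap U V i j * (p i * (Real.log (p i) - Real.log (t j))) := by
  rw [mul_sub, Matrix.trace_sub, Complex.sub_re, hU.trace_mul_self_re hU.mlog,
    hU.trace_mul_re hV.mlog, ← Finset.sum_sub_distrib]
  refine Finset.sum_congr rfl fun i _ => ?_
  conv_lhs => rw [← one_mul (p i * _), ← sum_overlap_right hU.left hV.right i, Finset.sum_mul,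
    ← Finset.sum_sub_distrib]
  exact Finset.sum_congr rfl fun j _ => by ring

theorem mulVec_col (h : Diagonalizes U A a) (j : n) :
    A *ᵥ (U *ᵥ Pi.single j 1) = (a j : ℂ) • (U *ᵥ Pi.single j 1) := by
  rw [h.eq, Matrix.mulVec_mulVec, mul_assoc, mul_assoc, h.left, mul_one, ← Matrix.mulVec_mulVec,
    Matrix.diagonal_mulVec_single, mul_one, ← Matrix.mulVec_smul]
  congr 1
  ext i
  by_cases hij : i = j
  · subst hij; simp
  · simp [hij]

end Diagonalizes

/-! ### Supports -/

theorem mem_supp_iff {v : EuclideanSpace ℂ n} :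
    v ∈ supp A ↔ ∃ w : n → ℂ, A *ᵥ w = v.ofLp := by
  rw [supp, LinearMap.mem_range]
  constructor
  · rintro ⟨w, rfl⟩
    exact ⟨w.ofLp, rfl⟩
  · rintro ⟨w, hw⟩
    refine ⟨WithLp.toLp 2 w, ?_⟩
    ext i
    simpa using congrFun hw i

theorem supp_le_iff_ker (hρ : ρ.IsHermitian) (hτ : τ.IsHermitian) :
    supp ρ ≤ supp τ ↔ ∀ v : n → ℂ, τ *ᵥ v = 0 → ρ *ᵥ v = 0 := by
  have key : ∀ {M : Matrix n n ℂ}, M.IsHermitian →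
      (supp M)ᗮ = LinearMap.ker (Matrix.toEuclideanLin M) := by
    intro M hM
    have hs := Matrix.isSymmetric_toEuclideanLin_iff.2 hM
    exact hs.orthogonal_range
  rw [← Submodule.orthogonal_le_orthogonal_iff, key hρ, key hτ]
  constructor
  · intro h v hv
    have := @h (WithLp.toLp 2 v) (by
      rw [LinearMap.mem_ker]; ext i; simpa using congrFun hv i)
    rw [LinearMap.mem_ker] at this
    ext i
    simpa using congrArg (fun w : EuclideanSpace ℂ n => w i) this
  · intro h v hv
    rw [LinearMap.mem_ker] at hv ⊢
    have h1 := h v.ofLp (by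
      ext i
      simpa using congrArg (fun w : EuclideanSpace ℂ n => w i) hv)
    ext i
    simpa using congrFun h1 i

/-- Absolute continuity in spectral coordinates. It guarantees that the junk value `Real.log 0 = 0`
at a zero eigenvalue of `τ` always carries weight zero. -/
theorem Diagonalizes.mul_overlap_eq_zero (hU : Diagonalizes U ρ p) (hV : Diagonalizes V τ t)
    (h : supp ρ ≤ supp τ) {i j : n} (hj : t j = 0) : overlap U V i j * p i = 0 := by
  rw [supp_le_iff_ker hU.isHermitian hV.isHermitian] at h
  have h1 := h (V *ᵥ Pi.single j 1) (by rw [hV.mulVec_col, hj]; simp)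
  have h2 : (Matrix.diagonal (fun i => (p i : ℂ)) * (Uᴴ * V)) *ᵥ Pi.single j 1 = 0 := by
    calc _ = Uᴴ *ᵥ (ρ *ᵥ (V *ᵥ Pi.single j 1)) := by
          rw [Matrix.mulVec_mulVec, Matrix.mulVec_mulVec, hU.eq]
          simp only [← mul_assoc]
          rw [hU.left, one_mul]
      _ = 0 := by rw [h1, Matrix.mulVec_zero]
  have h3 := congrFun h2 i
  rw [Matrix.mulVec_single_one, Matrix.col_apply, Matrix.diagonal_mul, Pi.zero_apply, mul_eq_zero,
    Complex.ofReal_eq_zero] at h3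
  rcases h3 with h3 | h3
  · rw [h3, mul_zero]
  · rw [overlap, h3, map_zero, zero_mul]

end Spectral

/-! ### Klein's inequality and Gibbs states -/

section Gibbs

variable {n : Type*} [Fintype n] [DecidableEq n] {A K H σ ρ τ U V : Matrix n n ℂ} {a p t : n → ℝ}

theorem Diagonalizes.sum_sum_overlap_mul_left (hU : Diagonalizes U ρ p)
    (hV : Diagonalizes V τ t) (g : n → ℝ) : ∑ i, ∑ j, overlap U V i j * g i = ∑ i, g i := by
  refine Finset.sum_congr rfl fun i _ => ?_
  rw [← Finset.sum_mul, sum_overlap_right hU.left hV.right, one_mul]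

theorem Diagonalizes.sum_sum_overlap_mul_right (hU : Diagonalizes U ρ p)
    (hV : Diagonalizes V τ t) (g : n → ℝ) : ∑ i, ∑ j, overlap U V i j * g j = ∑ j, g j := by
  rw [Finset.sum_comm]
  refine Finset.sum_congr rfl fun i _ => ?_
  rw [← Finset.sum_mul, sum_overlap_left hU.right hV.left, one_mul]

/-- The trace of a matrix whose support contains that of a density matrix is positive. -/
theorem trace_pos_of_supp_le (hσ : IsDensity σ) (hτ : τ.PosSemidef) (h : supp σ ≤ supp τ) :
    0 < τ.trace.re := by
  obtain ⟨U, p, hU, hp⟩ := exists_diagonalizes_nonneg hσ.1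
  obtain ⟨V, t, hV, ht⟩ := exists_diagonalizes_nonneg hτ
  rw [hV.trace_re]
  refine (Finset.sum_nonneg fun i _ => ht i).lt_of_ne' fun h0 => ?_
  rw [Finset.sum_eq_zero_iff_of_nonneg fun i _ => ht i] at h0
  have h1 : ∑ i, p i = 1 := by rw [← hU.trace_re, hσ.2, Complex.one_re]
  rw [← hU.sum_sum_overlap_mul_left hV] at h1
  simp [hU.mul_overlap_eq_zero hV h (h0 _ (Finset.mem_univ _))] at h1

/-- **Klein's inequality**. -/
theorem neg_log_trace_le (hσ : IsDensity σ) (hτ : τ.PosSemidef) (h : supp σ ≤ supp τ) :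
    -Real.log τ.trace.re ≤ (σ * (mlog σ - mlog τ)).trace.re := by
  have hZ := trace_pos_of_supp_le hσ hτ h
  obtain ⟨U, p, hU, hp⟩ := exists_diagonalizes_nonneg hσ.1
  obtain ⟨V, t, hV, ht⟩ := exists_diagonalizes_nonneg hτ
  have hs : ∑ i, p i = 1 := by rw [← hU.trace_re, hσ.2, Complex.one_re]
  set Z := τ.trace.re with hZdef
  have hZt : ∑ j, t j = Z := by rw [← hV.trace_re]
  have term : ∀ i j, overlap U V i j * p i - overlap U V i j * (t j / Z) ≤
      overlap U V i j * (p i * (Real.log (p i) - Real.log (t j))) +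
        overlap U V i j * (p i * Real.log Z) := by
    intro i j
    rw [← mul_sub, ← mul_add]
    rcases (overlap_nonneg U V i j).eq_or_lt with hc | hc
    · simp [← hc]
    refine mul_le_mul_of_nonneg_left ?_ hc.le
    rcases (hp i).eq_or_lt with hpi | hpi
    · rw [← hpi]
      simp only [zero_mul, zero_sub, add_zero, Left.neg_nonpos_iff]
      exact div_nonneg (ht j) hZ.le
    have htj : 0 < t j := (ht j).lt_of_ne' fun h0 => by
      have := hU.mul_overlap_eq_zero hV h (i := i) h0
      rw [mul_eq_zero] at this
      rcases this with h' | h'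
      · exact hc.ne' h'
      · exact hpi.ne' h'
    -- `1 - 1/x ≤ log x` at `x = p Z / t`; after summation both linear terms equal `1` and cancel,
    -- leaving `log Z`.
    have h1 := Real.one_sub_inv_le_log_of_pos (x := p i * Z / t j) (by positivity)
    rw [Real.log_div (by positivity) htj.ne', Real.log_mul hpi.ne' hZ.ne'] at h1
    have h2 := mul_le_mul_of_nonneg_left h1 hpi.le
    have h3 : p i * (1 - (p i * Z / t j)⁻¹) = p i - t j / Z := by field_simp
    rw [h3] at h2
    linarith
  have hsum := Finset.sum_le_sum fun i (_ : i ∈ Finset.univ) =>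
    Finset.sum_le_sum fun j (_ : j ∈ Finset.univ) => term i j
  simp only [Finset.sum_add_distrib, Finset.sum_sub_distrib] at hsum
  rw [hU.sum_sum_overlap_mul_left hV, hU.sum_sum_overlap_mul_right hV,
    hU.sum_sum_overlap_mul_left hV, ← Finset.sum_mul, hs, ← hU.trace_relEntropy hV,
    ← Finset.sum_div, hZt, div_self hZ.ne'] at hsum
  linarith

theorem relEntropy_trace_nonneg (hσ : IsDensity σ) (hτ : IsDensity τ) (h : supp σ ≤ supp τ) :
    0 ≤ (σ * (mlog σ - mlog τ)).trace.re := by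
  simpa [hτ.2] using neg_log_trace_le hσ hτ.1 h

theorem Diagonalizes.of_mulVec_col (hl : Uᴴ * U = 1) (hr : U * Uᴴ = 1)
    (h : ∀ j, A *ᵥ (U *ᵥ Pi.single j 1) = (a j : ℂ) • (U *ᵥ Pi.single j 1)) :
    Diagonalizes U A a := by
  refine ⟨hl, hr, ?_⟩
  have h1 : A * U = U * Matrix.diagonal (fun i => (a i : ℂ)) := by
    ext i j
    have := congrFun (h j) i
    rw [Matrix.mulVec_mulVec, Matrix.mulVec_single_one, Matrix.mulVec_single_one] at this
    rw [Matrix.mul_diagonal, mul_comm]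
    exact this
  rw [← h1, mul_assoc, hr, mul_one]

theorem Diagonalizes.exists_eq_of_mulVec (h : Diagonalizes U A a) {v : n → ℂ} {μ : ℝ}
    (hv : v ≠ 0) (hμ : A *ᵥ v = (μ : ℂ) • v) : ∃ j, a j = μ := by
  by_contra! hne
  apply hv
  have h1 : Matrix.diagonal (fun i => (a i : ℂ)) *ᵥ (Uᴴ *ᵥ v) = (μ : ℂ) • (Uᴴ *ᵥ v) := by
    rw [← Matrix.mulVec_smul, ← hμ, h.eq]
    simp only [Matrix.mulVec_mulVec, ← mul_assoc]
    rw [h.left, one_mul]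
  have h2 : Uᴴ *ᵥ v = 0 := by
    ext j
    have := congrFun h1 j
    rw [Matrix.mulVec_diagonal, Pi.smul_apply, smul_eq_mul] at this
    by_contra h0
    exact hne j (Complex.ofReal_inj.1 (mul_right_cancel₀ h0 this))
  calc v = (U * Uᴴ) *ᵥ v := by rw [h.right, Matrix.one_mulVec]
    _ = 0 := by rw [← Matrix.mulVec_mulVec, h2, Matrix.mulVec_zero]

theorem Diagonalizes.exp (h : Diagonalizes U A a) :
    Diagonalizes U (NormedSpace.exp A) (fun i => Real.exp (a i)) := by
  refine ⟨h.left, h.right, ?_⟩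
  have hinv : U⁻¹ = Uᴴ := Matrix.inv_eq_right_inv h.right
  have hu : IsUnit U := IsUnit.of_mul_eq_one _ h.right
  have h1 := Matrix.exp_conj U (Matrix.diagonal (fun i => (a i : ℂ))) hu
  rw [hinv, ← h.eq, Matrix.exp_diagonal] at h1
  rw [h1]
  congr 3
  ext i
  rw [Pi.coe_exp, ← Complex.exp_eq_exp_ℂ, Complex.ofReal_exp]

/-- Simultaneous diagonalization of a projection and a Hermitian matrix that lives on its range. -/
theorem exists_diagonalizes_proj {Q : Matrix n n ℂ} (hQ : Q.IsHermitian) (hQQ : Q * Q = Q)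
    (hK : K.IsHermitian) (hQK : Q * K = K) :
    ∃ W κ e, Diagonalizes W K κ ∧ Diagonalizes W Q e ∧
      ∀ j, (e j = 0 ∧ κ j = 0) ∨ e j = 1 := by
  have hKQ : K * Q = K := by
    have := congrArg Matrix.conjTranspose hQK
    rwa [Matrix.conjTranspose_mul, hK.eq, hQ.eq] at this
  obtain ⟨V, hV⟩ := exists_diagonalizes hK
  -- Since `c` is not an eigenvalue of `K`, the `c`-eigenspace of `K + c (1 - Q)` is exactly the
  -- kernel of `Q`. Any eigenbasis of this one matrix therefore diagonalizes both `K` and `Q`.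
  obtain ⟨c, hc⟩ := (Set.finite_range hK.eigenvalues).infinite_compl.nonempty
  have hL : (K + (c : ℂ) • (1 - Q)).IsHermitian := by
    refine hK.add ?_
    rw [Matrix.IsHermitian, Matrix.conjTranspose_smul, Matrix.conjTranspose_sub, hQ.eq]
    simp
  obtain ⟨W, hW⟩ := exists_diagonalizes hL
  set κ' := hL.eigenvalues
  have hcol : ∀ j, (κ' j = c → Q *ᵥ (W *ᵥ Pi.single j 1) = 0 ∧ K *ᵥ (W *ᵥ Pi.single j 1) = 0) ∧
      (κ' j ≠ c → Q *ᵥ (W *ᵥ Pi.single j 1) = W *ᵥ Pi.single j 1 ∧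
        K *ᵥ (W *ᵥ Pi.single j 1) = (κ' j : ℂ) • (W *ᵥ Pi.single j 1)) := by
    intro j
    have h1 := hW.mulVec_col j
    set w := W *ᵥ Pi.single j 1
    rw [Matrix.add_mulVec, Matrix.smul_mulVec, Matrix.sub_mulVec, Matrix.one_mulVec] at h1
    constructor
    · intro hj
      rw [hj, smul_sub] at h1
      have h2 : K *ᵥ w = (c : ℂ) • (Q *ᵥ w) := by
        have : K *ᵥ w - (c : ℂ) • (Q *ᵥ w) = 0 := by
          rw [← sub_eq_zero] at h1
          rw [← h1]; abel
        rwa [sub_eq_zero] at this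
      have h3 : Q *ᵥ w = 0 := by
        by_contra h0
        obtain ⟨i, hi⟩ := hV.exists_eq_of_mulVec h0 (μ := c) (by
          rw [Matrix.mulVec_mulVec, hKQ, h2])
        exact hc ⟨i, hi⟩
      exact ⟨h3, by rw [h2, h3, smul_zero]⟩
    · intro hj
      have h2 := congrArg (fun v => Q *ᵥ v) h1
      simp only [Matrix.mulVec_add, Matrix.mulVec_smul, Matrix.mulVec_sub, Matrix.mulVec_mulVec,
        hQK, hQQ, sub_self, smul_zero, add_zero] at h2
      rw [h2, smul_sub] at h1
      have h3 : ((κ' j : ℂ) - c) • (Q *ᵥ w - w) = 0 := by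
        rw [← sub_eq_zero] at h1
        rw [← h1, sub_smul, smul_sub, smul_sub]; abel
      rw [smul_eq_zero, sub_eq_zero, Complex.ofReal_inj, sub_eq_zero] at h3
      have h4 := h3.resolve_left hj
      exact ⟨h4, by rw [h2, h4]⟩
  classical
  refine ⟨W, fun j => if κ' j = c then 0 else κ' j, fun j => if κ' j = c then 0 else 1,
    .of_mulVec_col hW.left hW.right fun j => ?_, .of_mulVec_col hW.left hW.right fun j => ?_,
    fun j => ?_⟩
  · by_cases hj : κ' j = c
    · simp only [hj, if_true, Complex.ofReal_zero, zero_smul]; exact ((hcol j).1 hj).2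
    · simp only [hj, if_false]; exact ((hcol j).2 hj).2
  · by_cases hj : κ' j = c
    · simp only [hj, if_true, Complex.ofReal_zero, zero_smul]; exact ((hcol j).1 hj).1
    · simp only [hj, if_false, Complex.ofReal_one, one_smul]; exact ((hcol j).2 hj).1
  · by_cases hj : κ' j = c <;> simp [hj]

theorem Diagonalizes.supp_le (hU : Diagonalizes U ρ p) (hV : Diagonalizes U τ t)
    (h : ∀ j, t j = 0 → p j = 0) : supp ρ ≤ supp τ := by
  rw [supp_le_iff_ker hU.isHermitian hV.isHermitian]
  intro v hv
  have h1 : Matrix.diagonal (fun i => (t i : ℂ)) *ᵥ (Uᴴ *ᵥ v) = 0 := by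
    calc _ = Uᴴ *ᵥ (τ *ᵥ v) := by
          rw [hV.eq]
          simp only [Matrix.mulVec_mulVec, ← mul_assoc]
          rw [hV.left, one_mul]
      _ = 0 := by rw [hv, Matrix.mulVec_zero]
  have h2 : Matrix.diagonal (fun i => (p i : ℂ)) *ᵥ (Uᴴ *ᵥ v) = 0 := by
    ext j
    have := congrFun h1 j
    rw [Matrix.mulVec_diagonal, Pi.zero_apply, mul_eq_zero, Complex.ofReal_eq_zero] at this ⊢
    exact this.imp_left (h j)
  rw [hU.eq, mul_assoc, ← Matrix.mulVec_mulVec, ← Matrix.mulVec_mulVec, h2, Matrix.mulVec_zero]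

theorem projMatrix_mulVec (S : Submodule ℂ (EuclideanSpace ℂ n)) (v : n → ℂ) :
    projMatrix S *ᵥ v = (S.starProjection (WithLp.toLp 2 v)).ofLp := by
  have h : Matrix.toEuclideanLin (projMatrix S) = S.starProjection.toLinearMap :=
    LinearEquiv.apply_symm_apply _ _
  have h2 := congrArg (fun f => (f (WithLp.toLp 2 v)).ofLp) h
  exact h2

theorem projMatrix_isHermitian (S : Submodule ℂ (EuclideanSpace ℂ n)) :
    (projMatrix S).IsHermitian := by
  rw [← Matrix.isSymmetric_toEuclideanLin_iff, projMatrix, LinearEquiv.apply_symm_apply]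
  exact S.starProjection_isSymmetric

theorem supp_projMatrix (S : Submodule ℂ (EuclideanSpace ℂ n)) : supp (projMatrix S) = S := by
  rw [supp, projMatrix, LinearEquiv.apply_symm_apply]
  exact S.range_starProjection

theorem projMatrix_mul_eq_self {S : Submodule ℂ (EuclideanSpace ℂ n)} (h : supp A ≤ S) :
    projMatrix S * A = A := by
  apply Matrix.ext_of_mulVec_single
  intro j
  rw [← Matrix.mulVec_mulVec, projMatrix_mulVec,
    Submodule.starProjection_eq_self_iff.2 (h (mem_supp_iff.2 ⟨_, rfl⟩))]

theorem projMatrix_mul_self (S : Submodule ℂ (EuclideanSpace ℂ n)) :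
    projMatrix S * projMatrix S = projMatrix S :=
  projMatrix_mul_eq_self (supp_projMatrix S).le

theorem mul_projMatrix_eq_self {S : Submodule ℂ (EuclideanSpace ℂ n)} (hA : A.IsHermitian)
    (h : supp A ≤ S) : A * projMatrix S = A := by
  have := congrArg Matrix.conjTranspose (projMatrix_mul_eq_self h)
  rwa [Matrix.conjTranspose_mul, hA.eq, (projMatrix_isHermitian S).eq] at this

theorem mlog_isHermitian (hA : A.IsHermitian) : (mlog A).IsHermitian := by
  obtain ⟨U, hU⟩ := exists_diagonalizes hA
  exact hU.mlog.isHermitian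

/-- The compression of `H` to the subspace `S`. -/
noncomputable def compress (S : Submodule ℂ (EuclideanSpace ℂ n)) (H : Matrix n n ℂ) :
    Matrix n n ℂ :=
  projMatrix S * H * projMatrix S

/-- The exponential on `S` of the compression of `H`, extended by zero. -/
noncomputable def expOn (S : Submodule ℂ (EuclideanSpace ℂ n)) (H : Matrix n n ℂ) :
    Matrix n n ℂ :=
  projMatrix S * NormedSpace.exp (compress S H)

variable {S : Submodule ℂ (EuclideanSpace ℂ n)}

theorem exists_diagonalizes_compress (S : Submodule ℂ (EuclideanSpace ℂ n))
    (hH : H.IsHermitian) :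
    ∃ W κ e, Diagonalizes W (compress S H) κ ∧ Diagonalizes W (projMatrix S) e ∧
      ∀ j, (e j = 0 ∧ κ j = 0) ∨ e j = 1 := by
  refine exists_diagonalizes_proj (projMatrix_isHermitian S) (projMatrix_mul_self S) ?_ ?_
  · rw [compress, Matrix.IsHermitian, Matrix.conjTranspose_mul, Matrix.conjTranspose_mul,
      (projMatrix_isHermitian S).eq, hH.eq, mul_assoc]
  · rw [compress, ← mul_assoc, ← mul_assoc, projMatrix_mul_self]

theorem trace_mul_compress (hσ : σ.IsHermitian) (h : supp σ ≤ S) :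
    (σ * compress S H).trace = (σ * H).trace := by
  rw [compress, ← mul_assoc, Matrix.trace_mul_comm, ← mul_assoc, ← mul_assoc,
    projMatrix_mul_eq_self h, mul_projMatrix_eq_self hσ h]

theorem posSemidef_expOn (hH : H.IsHermitian) : (expOn S H).PosSemidef := by
  obtain ⟨W, κ, e, hκ, he, hj⟩ := exists_diagonalizes_compress S hH
  refine (he.mul_self hκ.exp).posSemidef fun j => ?_
  rcases hj j with h | h <;> simp [h, Real.exp_nonneg]

theorem supp_expOn (hH : H.IsHermitian) : supp (expOn S H) = S := by
  obtain ⟨W, κ, e, hκ, he, hj⟩ := exists_diagonalizes_compress S hH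
  conv_rhs => rw [← supp_projMatrix S]
  refine le_antisymm ((he.mul_self hκ.exp).supp_le he fun j h => by simp [h])
    (he.supp_le (he.mul_self hκ.exp) fun j h => ?_)
  exact (mul_eq_zero.1 h).resolve_right (Real.exp_ne_zero _)

/-- Off `S` the eigenvalue of `expOn` is `0`, and `Real.log 0 = 0` agrees with the zero extension of
the compression. -/
theorem mlog_expOn (hH : H.IsHermitian) : mlog (expOn S H) = compress S H := by
  obtain ⟨W, κ, e, hκ, he, hj⟩ := exists_diagonalizes_compress S hH
  have h1 := (he.mul_self hκ.exp).mlog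
  have h2 : (fun i => Real.log (e i * Real.exp (κ i))) = κ := by
    ext j
    rcases hj j with h | h <;> simp [h]
  rw [h2] at h1
  rw [hκ.eq]
  exact h1.eq

theorem trace_expOn_pos (hσ : IsDensity σ) (h : supp σ ≤ S) (hH : H.IsHermitian) :
    0 < (expOn S H).trace.re :=
  trace_pos_of_supp_le hσ (posSemidef_expOn hH) (h.trans (supp_expOn hH).ge)

/-- The Gibbs variational inequality on a subspace. -/
theorem neg_log_trace_expOn_le (hσ : IsDensity σ) (h : supp σ ≤ S) (hH : H.IsHermitian) :
    -Real.log (expOn S H).trace.re ≤ (σ * mlog σ).trace.re - (σ * H).trace.re := by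
  have := neg_log_trace_le hσ (posSemidef_expOn hH) (h.trans (supp_expOn hH).ge)
  rwa [mlog_expOn hH, mul_sub, Matrix.trace_sub, Complex.sub_re,
    trace_mul_compress hσ.1.1 h] at this

/-- The Gibbs state attains equality in the variational inequality. -/
theorem exists_gibbs (hσ : IsDensity σ) (h : supp σ ≤ S) (hH : H.IsHermitian) :
    ∃ γ, IsDensity γ ∧ supp γ ≤ S ∧
      -Real.log (expOn S H).trace.re = (γ * mlog γ).trace.re - (γ * H).trace.re := by
  -- The density matrix `σ` on `S` rules out `S = 0`, so the partition function can be divided out.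
  have hZ := trace_expOn_pos hσ h hH
  obtain ⟨W, κ, e, hκ, he, hj⟩ := exists_diagonalizes_compress S hH
  have hN : Diagonalizes W (expOn S H) _ := he.mul_self hκ.exp
  set Z := (expOn S H).trace.re with hZdef
  have hγ := hN.smul Z⁻¹
  have hsum : ∑ j, e j * Real.exp (κ j) = Z := by rw [hZdef, hN.trace_re]
  have hpos : (((Z⁻¹ : ℝ) : ℂ) • expOn S H).PosSemidef := hγ.posSemidef fun j => by
    rcases hj j with h | h
    · simp [h]
    · rw [h]; positivity
  have hs : supp (((Z⁻¹ : ℝ) : ℂ) • expOn S H) ≤ S := by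
    conv_rhs => rw [← supp_projMatrix S]
    exact hγ.supp_le he fun j h => by simp [h]
  have htr : ∑ j, Z⁻¹ * (e j * Real.exp (κ j)) = 1 := by
    rw [← Finset.mul_sum, hsum, inv_mul_cancel₀ hZ.ne']
  refine ⟨_, ⟨hpos, ?_⟩, hs, ?_⟩
  · rw [hγ.trace]; exact_mod_cast htr
  · rw [← trace_mul_compress (H := H) hpos.1 hs, hγ.trace_mul_self_re hγ.mlog,
      hγ.trace_mul_self_re hκ, ← Finset.sum_sub_distrib]
    rw [← one_mul (Real.log Z), ← neg_mul, ← htr, ← Finset.sum_neg_distrib, Finset.sum_mul]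
    refine Finset.sum_congr rfl fun j _ => ?_
    rcases hj j with h | h
    · simp [h]
    · rw [h, one_mul, Real.log_mul (by positivity) (by positivity), Real.log_inv, Real.log_exp]
      ring

end Gibbs

/-! ### The output state of a classical-quantum channel -/

/-- The block diagonal matrix with the blocks `M x`. -/
def blk {X B : Type*} [DecidableEq X] (M : X → Matrix B B ℂ) : Matrix (X × B) (X × B) ℂ :=
  Matrix.of fun p s => if p.1 = s.1 then M p.1 p.2 s.2 else 0

section Blocks

variable {X B : Type*} [Fintype X] [DecidableEq X] [Fintype B] [DecidableEq B]
  {M N : X → Matrix B B ℂ}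

theorem blk_mul (M N : X → Matrix B B ℂ) : blk M * blk N = blk fun x => M x * N x := by
  ext ⟨x, i⟩ ⟨y, j⟩
  simp only [blk, Matrix.mul_apply, Matrix.of_apply, Fintype.sum_prod_type]
  rw [Finset.sum_eq_single x]
  · by_cases h : x = y <;> simp [h]
  · intro z _ hz
    simp [hz.symm]
  · simp

theorem blk_conjTranspose (M : X → Matrix B B ℂ) : (blk M)ᴴ = blk fun x => (M x)ᴴ := by
  ext ⟨x, i⟩ ⟨y, j⟩
  by_cases h : x = y
  · subst h; simp [blk]
  · simp [blk, h, Ne.symm h]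

theorem blk_one : blk (fun _ : X => (1 : Matrix B B ℂ)) = 1 := by
  ext ⟨x, i⟩ ⟨y, j⟩
  by_cases h : x = y <;> simp [blk, h, Matrix.one_apply]

theorem blk_diagonal (d : X → B → ℂ) :
    blk (fun x => Matrix.diagonal (d x)) = Matrix.diagonal fun p : X × B => d p.1 p.2 := by
  ext ⟨x, i⟩ ⟨y, j⟩
  by_cases h : x = y
  · subst h; simp [blk, Matrix.diagonal_apply]
  · simp [blk, h]

theorem blk_sub (M N : X → Matrix B B ℂ) : blk M - blk N = blk fun x => M x - N x := by
  ext ⟨x, i⟩ ⟨y, j⟩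
  by_cases h : x = y <;> simp [blk, h]

theorem trace_blk (M : X → Matrix B B ℂ) : (blk M).trace = ∑ x, (M x).trace := by
  simp [blk, Matrix.trace, Fintype.sum_prod_type]

theorem Diagonalizes.blk {U : X → Matrix B B ℂ} {m : X → B → ℝ}
    (h : ∀ x, Diagonalizes (U x) (M x) (m x)) :
    Diagonalizes (blk U) (blk M) fun p => m p.1 p.2 := by
  refine ⟨?_, ?_, ?_⟩
  · rw [blk_conjTranspose, blk_mul, ← blk_one]
    exact congrArg Umlaut.blk (funext fun x => (h x).left)
  · rw [blk_conjTranspose, blk_mul, ← blk_one]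
    exact congrArg Umlaut.blk (funext fun x => (h x).right)
  · rw [← blk_diagonal (fun x i => (m x i : ℂ)), blk_conjTranspose, blk_mul, blk_mul]
    exact congrArg Umlaut.blk (funext fun x => (h x).eq)

theorem blk_isHermitian (h : ∀ x, (M x).IsHermitian) : (blk M).IsHermitian := by
  rw [Matrix.IsHermitian, blk_conjTranspose]
  exact congrArg blk (funext fun x => (h x).eq)

theorem mlog_blk (h : ∀ x, (M x).IsHermitian) : mlog (blk M) = blk fun x => mlog (M x) := by
  choose U hU using fun x => exists_diagonalizes (h x)
  rw [(Diagonalizes.blk hU).mlog.eq, (Diagonalizes.blk fun x => (hU x).mlog).eq]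

theorem blk_mulVec (M : X → Matrix B B ℂ) (v : X × B → ℂ) (x : X) (i : B) :
    (blk M *ᵥ v) (x, i) = (M x *ᵥ fun j => v (x, j)) i := by
  simp only [Matrix.mulVec, dotProduct, blk, Matrix.of_apply, Fintype.sum_prod_type]
  rw [Finset.sum_eq_single x]
  · simp
  · intro z _ hz
    simp [hz.symm]
  · simp

theorem supp_blk_le_iff (hM : ∀ x, (M x).IsHermitian) (hN : ∀ x, (N x).IsHermitian) :
    supp (blk M) ≤ supp (blk N) ↔ ∀ x, supp (M x) ≤ supp (N x) := by
  simp only [supp_le_iff_ker (blk_isHermitian hM) (blk_isHermitian hN),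
    fun x => supp_le_iff_ker (hM x) (hN x)]
  constructor
  · intro h x v hv
    have h1 := h (fun p => if p.1 = x then v p.2 else 0) (by
      ext ⟨y, i⟩
      rw [blk_mulVec]
      by_cases hy : y = x
      · subst hy; simp [hv]
      · simp only [hy, if_false, Pi.zero_apply]
        exact congrFun (Matrix.mulVec_zero (N y)) i)
    ext i
    have := congrFun h1 (x, i)
    rw [blk_mulVec] at this
    simpa using this
  · intro h v hv
    ext ⟨x, i⟩
    rw [blk_mulVec]
    refine congrFun (h x _ ?_) i
    ext j
    rw [← blk_mulVec, hv]
    rfl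

theorem marginalFst_blk_kronecker (M : X → Matrix B B ℂ) (σ : Matrix B B ℂ) :
    marginalFst (blk M) ⊗ₖ σ = blk fun x => (M x).trace • σ := by
  ext ⟨x, i⟩ ⟨y, j⟩
  by_cases h : x = y
  · subst h; simp [blk, marginalFst, Matrix.trace]
  · simp [blk, marginalFst, h]

/-- The channel reads only the diagonal of its input, which annihilates the coherences of `Φ`. -/
theorem outputState_eq_blk (ρ : X → Matrix B B ℂ) {P : X → ℝ} (hP : ∀ x, 0 ≤ P x) :
    outputState (cqChannel ρ) P = blk fun x => (P x : ℂ) • ρ x := by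
  have h : (Matrix.diagonal (fun x => ((√(P x) : ℝ) : ℂ)) ⊗ₖ (1 : Matrix X X ℂ)) =
      Matrix.diagonal fun p : X × X => ((√(P p.1) : ℝ) : ℂ) := by
    rw [← Matrix.diagonal_one, Matrix.diagonal_kronecker_diagonal]
    simp
  ext ⟨x, i⟩ ⟨y, j⟩
  simp only [outputState, h, idTensor, cqChannel, Matrix.of_apply, LinearMap.coe_mk,
    AddHom.coe_mk, Matrix.mul_diagonal, Matrix.diagonal_mul, maxEntangled, Matrix.sum_apply,
    Matrix.smul_apply, smul_eq_mul, blk]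
  by_cases hxy : x = y
  · subst hxy
    rw [Finset.sum_eq_single x]
    · simp only [and_self, if_true, mul_one, ← Complex.ofReal_mul, Real.mul_self_sqrt (hP x)]
    · intro z _ hz
      simp [Ne.symm hz]
    · simp
  · rw [if_neg hxy, Finset.sum_eq_zero]
    intro z _
    rw [if_neg (by rintro ⟨rfl, rfl⟩; exact hxy rfl)]
    simp

end Blocks

/-! ### Relative entropy to the output state of a distribution -/

section Output

variable {X B : Type*} [Fintype X] [DecidableEq X] [Fintype B] [DecidableEq B]
  {ρ : X → Matrix B B ℂ} {P : X → ℝ} {σ τ : Matrix B B ℂ}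

theorem ofReal_smul_isHermitian {A : Matrix B B ℂ} (hA : A.IsHermitian) (r : ℝ) :
    ((r : ℂ) • A).IsHermitian := by
  rw [Matrix.IsHermitian, Matrix.conjTranspose_smul, hA.eq]
  simp

theorem supp_smul_le_iff (hσ : σ.IsHermitian) (hτ : τ.IsHermitian) (r : ℝ) :
    supp ((r : ℂ) • σ) ≤ supp ((r : ℂ) • τ) ↔ (r ≠ 0 → supp σ ≤ supp τ) := by
  by_cases hr : r = 0
  · simp [hr]
  · rw [supp_le_iff_ker (ofReal_smul_isHermitian hσ r) (ofReal_smul_isHermitian hτ r),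
      supp_le_iff_ker hσ hτ]
    simp [Matrix.smul_mulVec, hr]

/-- The two copies of `log r` cancel. The support hypothesis discards the terms with `t j = 0`,
where `Real.log` of the product would not split. -/
theorem trace_relEntropy_smul (hσ : σ.PosSemidef) (hτ : τ.PosSemidef) (r : ℝ)
    (h : r ≠ 0 → supp σ ≤ supp τ) :
    (((r : ℂ) • σ) * (mlog ((r : ℂ) • σ) - mlog ((r : ℂ) • τ))).trace.re =
      r * (σ * (mlog σ - mlog τ)).trace.re := by
  by_cases hr : r = 0
  · simp [hr]
  obtain ⟨U, p, hU, hp⟩ := exists_diagonalizes_nonneg hσ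
  obtain ⟨V, t, hV, ht⟩ := exists_diagonalizes_nonneg hτ
  rw [(hU.smul r).trace_relEntropy (hV.smul r), hU.trace_relEntropy hV, Finset.mul_sum]
  refine Finset.sum_congr rfl fun i _ => ?_
  rw [Finset.mul_sum]
  refine Finset.sum_congr rfl fun j _ => ?_
  by_cases hc : overlap U V i j * p i = 0
  · rcases mul_eq_zero.1 hc with h0 | h0 <;> simp [h0]
  · have hpi : p i ≠ 0 := right_ne_zero_of_mul hc
    have htj : t j ≠ 0 := fun h0 => hc (hU.mul_overlap_eq_zero hV (h hr) h0)
    rw [Real.log_mul hr hpi, Real.log_mul hr htj]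
    ring

theorem supp_output_le_iff (hρ : ∀ x, IsDensity (ρ x)) (hP : ∀ x, 0 ≤ P x) (hσ : IsDensity σ) :
    supp (marginalFst (outputState (cqChannel ρ) P) ⊗ₖ σ) ≤ supp (outputState (cqChannel ρ) P) ↔
      ∀ x, P x ≠ 0 → supp σ ≤ supp (ρ x) := by
  rw [outputState_eq_blk ρ hP, marginalFst_blk_kronecker]
  simp only [Matrix.trace_smul, (hρ _).2, smul_eq_mul, mul_one]
  rw [supp_blk_le_iff (fun x => ofReal_smul_isHermitian hσ.1.1 _)
    (fun x => ofReal_smul_isHermitian (hρ x).1.1 _)]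
  exact forall_congr' fun x => supp_smul_le_iff hσ.1.1 (hρ x).1.1 _

theorem relEntropy_output (hρ : ∀ x, IsDensity (ρ x)) (hP : ∀ x, 0 ≤ P x) (hσ : IsDensity σ)
    (h : ∀ x, P x ≠ 0 → supp σ ≤ supp (ρ x)) :
    relEntropy (marginalFst (outputState (cqChannel ρ) P) ⊗ₖ σ) (outputState (cqChannel ρ) P) =
      ((∑ x, P x * (σ * (mlog σ - mlog (ρ x))).trace.re : ℝ) : EReal) := by
  rw [relEntropy, if_pos ((supp_output_le_iff hρ hP hσ).2 h), outputState_eq_blk ρ hP,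
    marginalFst_blk_kronecker]
  simp only [Matrix.trace_smul, (hρ _).2, smul_eq_mul, mul_one]
  rw [mlog_blk (fun x => ofReal_smul_isHermitian hσ.1.1 _),
    mlog_blk (fun x => ofReal_smul_isHermitian (hρ x).1.1 _), blk_sub, blk_mul, trace_blk,
    Complex.re_sum]
  simp only [fun x => trace_relEntropy_smul hσ.1 (hρ x).1 (P x) (h x)]

theorem relEntropy_output_eq_top (hρ : ∀ x, IsDensity (ρ x)) (hP : ∀ x, 0 ≤ P x)
    (hσ : IsDensity σ) (h : ¬ ∀ x, P x ≠ 0 → supp σ ≤ supp (ρ x)) :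
    relEntropy (marginalFst (outputState (cqChannel ρ) P) ⊗ₖ σ) (outputState (cqChannel ρ) P) =
      ⊤ := by
  rw [relEntropy, if_neg (mt (supp_output_le_iff hρ hP hσ).1 h)]

/-- Separates the entropy of `σ` from a part linear in `P`, the form that matches the Gibbs
inequality. -/
theorem sum_mul_relEntropy_trace (hP : ∑ x, P x = 1) :
    ∑ x, P x * (σ * (mlog σ - mlog (ρ x))).trace.re =
      (σ * mlog σ).trace.re - ∑ x, P x * (σ * mlog (ρ x)).trace.re := by
  simp only [mul_sub, Matrix.trace_sub, Complex.sub_re, Finset.sum_sub_distrib]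
  rw [← Finset.sum_mul, hP, one_mul]

end Output

/-! ### Averages over tuples of independent symbols -/

section Tuples

variable {X : Type*} [Fintype X] {P : X → ℝ} {k : ℕ}

theorem sum_prod_eq_one (hP : ∑ x, P x = 1) : ∑ x : Fin k → X, ∏ i, P (x i) = 1 := by
  classical
  rw [← Fintype.piFinset_univ, ← Finset.prod_univ_sum (fun _ => Finset.univ) fun _ y => P y]
  simp [hP]

theorem sum_prod_mul_apply (hP : ∑ x, P x = 1) (g : X → ℝ) (j : Fin k) :
    ∑ x : Fin k → X, (∏ i, P (x i)) * g (x j) = ∑ y, P y * g y := by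
  classical
  -- Writing `g (x j)` as a product over all positions makes the summand a product, so the sum
  -- factorizes position by position.
  have h : ∀ x : Fin k → X, (∏ i, P (x i)) * g (x j) =
      ∏ i, (P (x i) * if i = j then g (x i) else 1) := fun x => by
    rw [Finset.prod_mul_distrib, Finset.prod_ite_eq' Finset.univ j]; simp
  simp only [h]
  rw [← Fintype.piFinset_univ, ← Finset.prod_univ_sum (fun _ => Finset.univ)
    fun i y => P y * if i = j then g y else 1, Finset.prod_eq_single j]
  · simp
  · intro i _ hi
    simp [hi, hP]
  · simp

theorem sum_prod_mul_apply_mul_apply_eq_zero (g : X → ℝ) (hg : ∑ y, P y * g y = 0) {j l : Fin k}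
    (hjl : j ≠ l) : ∑ x : Fin k → X, (∏ i, P (x i)) * (g (x j) * g (x l)) = 0 := by
  classical
  have h : ∀ x : Fin k → X, (∏ i, P (x i)) * (g (x j) * g (x l)) =
      ∏ i, (P (x i) * ((if i = j then g (x i) else 1) * if i = l then g (x i) else 1)) :=
    fun x => by
      rw [Finset.prod_mul_distrib, Finset.prod_mul_distrib, Finset.prod_ite_eq' Finset.univ j,
        Finset.prod_ite_eq' Finset.univ l]
      simp
  simp only [h]
  rw [← Fintype.piFinset_univ, ← Finset.prod_univ_sum (fun _ => Finset.univ)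
    fun i y => P y * ((if i = j then g y else 1) * if i = l then g y else 1)]
  refine Finset.prod_eq_zero (Finset.mem_univ j) ?_
  simpa [hjl] using hg

/-- The second moment of a sum of independent centred variables. -/
theorem sum_prod_mul_sq (hP : ∑ x, P x = 1) (g : X → ℝ) (hg : ∑ y, P y * g y = 0) :
    ∑ x : Fin k → X, (∏ i, P (x i)) * (∑ j, g (x j)) ^ 2 = k * ∑ y, P y * g y ^ 2 := by
  have h : ∀ x : Fin k → X, (∏ i, P (x i)) * (∑ j, g (x j)) ^ 2 =
      ∑ j, ∑ l, (∏ i, P (x i)) * (g (x j) * g (x l)) := fun x => by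
    rw [sq, Finset.sum_mul_sum, Finset.mul_sum]
    exact Finset.sum_congr rfl fun j _ => Finset.mul_sum ..
  simp only [h]
  rw [Finset.sum_comm]
  have : ∀ j : Fin k, ∑ x : Fin k → X, ∑ l, (∏ i, P (x i)) * (g (x j) * g (x l)) =
      ∑ y, P y * g y ^ 2 := fun j => by
    rw [Finset.sum_comm, Finset.sum_eq_single j]
    · simp only [← sq]
      exact sum_prod_mul_apply hP (fun y => g y ^ 2) j
    · intro l _ hl
      exact sum_prod_mul_apply_mul_apply_eq_zero g hg hl.symm
    · simp
  simp [this]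

/-- Chebyshev's inequality for empirical frequencies. -/
theorem sum_prod_ite_le [DecidableEq X] (hP : P ∈ stdSimplex ℝ X) (hk : 1 ≤ k) {c : ℝ}
    (hc : 0 < c) (bad : (Fin k → X) → Prop) [DecidablePred bad]
    (hbad : ∀ x, bad x → ∃ y, (1 / k : ℝ) * (∑ j, if x j = y then 1 else 0) < P y - c) :
    ∑ x : Fin k → X, (if bad x then ∏ i, P (x i) else 0) ≤ 1 / (k * c ^ 2) := by
  have hk0 : (0 : ℝ) < k := by exact_mod_cast hk
  have hprod : ∀ x : Fin k → X, 0 ≤ ∏ i, P (x i) := fun x =>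
    Finset.prod_nonneg fun i _ => hP.1 _
  let g : X → X → ℝ := fun y z => (if z = y then 1 else 0) - P y
  have hg : ∀ y, ∑ z, P z * g y z = 0 := fun y => by
    simp [g, mul_sub, Finset.sum_sub_distrib, ← Finset.sum_mul, hP.2]
  -- The variance of an indicator is `P y (1 - P y)`. Bounding it by `P y` makes the total over `y`
  -- at most `1`, so no factor `|X|` appears.
  have hg2 : ∀ y, ∑ z, P z * g y z ^ 2 ≤ P y := fun y => by
    have : ∀ z, P z * g y z ^ 2 = (1 - 2 * P y) * (P z * if z = y then 1 else 0) +
        P y ^ 2 * P z := fun z => by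
      by_cases hz : z = y <;> simp [g, hz] <;> ring
    simp only [this, Finset.sum_add_distrib, ← Finset.mul_sum, hP.2]
    simp only [mul_ite, mul_one, mul_zero, Finset.sum_ite_eq', Finset.mem_univ, if_true]
    nlinarith [sq_nonneg (P y)]
  -- Markov's inequality pointwise: on a bad tuple one symbol alone already contributes `(k c)²` to
  -- the sum of squares.
  have hpt : ∀ x : Fin k → X, (if bad x then ∏ i, P (x i) else 0) ≤
      (∏ i, P (x i)) * (1 / (k * c) ^ 2 * ∑ y, (∑ j, g y (x j)) ^ 2) := by
    intro x
    split_ifs with hx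
    · obtain ⟨y, hy⟩ := hbad x hx
      refine le_mul_of_one_le_right (hprod x) ?_
      have h1 : ∑ j, g y (x j) = (∑ j, if x j = y then (1 : ℝ) else 0) - k * P y := by
        simp [g, Finset.sum_sub_distrib]
      have h2 : k * c ≤ -∑ j, g y (x j) := by
        rw [h1]
        have := mul_lt_mul_of_pos_left hy hk0
        rw [← mul_assoc, mul_one_div_cancel hk0.ne', one_mul] at this
        linarith
      have h3 : (k * c) ^ 2 ≤ (∑ j, g y (x j)) ^ 2 := by
        rw [← neg_sq (∑ j, g y (x j))]
        exact pow_le_pow_left₀ (by positivity) h2 2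
      have h4 : (∑ j, g y (x j)) ^ 2 ≤ ∑ y, (∑ j, g y (x j)) ^ 2 :=
        Finset.single_le_sum (f := fun y => (∑ j, g y (x j)) ^ 2) (fun _ _ => sq_nonneg _)
          (Finset.mem_univ y)
      rw [one_div_mul_eq_div, one_le_div (by positivity)]
      exact h3.trans h4
    · exact mul_nonneg (hprod x) (mul_nonneg (by positivity)
        (Finset.sum_nonneg fun _ _ => sq_nonneg _))
  calc _ ≤ ∑ x : Fin k → X, (∏ i, P (x i)) * (1 / (k * c) ^ 2 * ∑ y, (∑ j, g y (x j)) ^ 2) :=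
        Finset.sum_le_sum fun x _ => hpt x
    _ = 1 / (k * c) ^ 2 * ∑ y, ∑ x : Fin k → X, (∏ i, P (x i)) * (∑ j, g y (x j)) ^ 2 := by
        rw [Finset.sum_comm, Finset.mul_sum]
        refine Finset.sum_congr rfl fun x _ => ?_
        rw [Finset.mul_sum, Finset.mul_sum, Finset.mul_sum]
        exact Finset.sum_congr rfl fun y _ => by ring
    _ = 1 / (k * c) ^ 2 * ∑ y, k * ∑ z, P z * g y z ^ 2 := by
        simp only [fun y => sum_prod_mul_sq (k := k) hP.2 (g y) (hg y)]
    _ ≤ 1 / (k * c) ^ 2 * ∑ y, k * P y := by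
        gcongr with y
        exact hg2 y
    _ = 1 / (k * c ^ 2) := by
        rw [← Finset.mul_sum, hP.2]
        field_simp

end Tuples

/-! ### The lower bound -/

theorem coe_ereal_sum {ι : Type*} (s : Finset ι) (f : ι → ℝ) :
    ((∑ i ∈ s, f i : ℝ) : EReal) = ∑ i ∈ s, (f i : EReal) := by
  classical
  induction s using Finset.induction_on with
  | empty => simp
  | insert i s hi ih => rw [Finset.sum_insert hi, Finset.sum_insert hi, EReal.coe_add, ih]

section LowerBound

variable {X B : Type*} [Fintype X] [DecidableEq X] [Fintype B] [DecidableEq B]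
  {ρ : X → Matrix B B ℂ} {P : X → ℝ} {σ : Matrix B B ℂ}

theorem isHermitian_sum_smul_mlog {ι : Type*} [Fintype ι] {τ : ι → Matrix B B ℂ}
    (hτ : ∀ i, (τ i).IsHermitian) (q : ι → ℝ) :
    (∑ i, (q i : ℂ) • mlog (τ i)).IsHermitian :=
  isSelfAdjoint_sum _ fun i _ => ofReal_smul_isHermitian (mlog_isHermitian (hτ i)) _

theorem trace_mul_sum_smul_re {ι : Type*} [Fintype ι] (q : ι → ℝ) (M : ι → Matrix B B ℂ) :
    (σ * ∑ i, (q i : ℂ) • M i).trace.re = ∑ i, q i * (σ * M i).trace.re := by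
  rw [Matrix.mul_sum, Matrix.trace_sum, Complex.re_sum]
  refine Finset.sum_congr rfl fun i _ => ?_
  rw [Matrix.mul_smul, Matrix.trace_smul, smul_eq_mul, Complex.re_ofReal_mul]

theorem trExpLog_eq {ι : Type*} [Fintype ι] {q : ι → ℝ} {τ : ι → Matrix B B ℂ}
    (h : ∀ i, q i < 0 → posSupp q τ ≤ supp (τ i)) :
    trExpLog q τ =
      ENNReal.ofReal (expOn (posSupp q τ) (∑ i, (q i : ℂ) • mlog (τ i))).trace.re := by
  rw [trExpLog, if_pos h]
  rfl

/-- When a negative weight violates the support condition, the left side is `-∞`. Otherwise `supp σ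
≤ posSupp q τ`, and the Gibbs inequality applies there. -/
theorem neg_log_trExpLog_le {ι : Type*} [Fintype ι] {q : ι → ℝ} {τ : ι → Matrix B B ℂ}
    (hτ : ∀ i, (τ i).IsHermitian) (hσ : IsDensity σ) (h : ∀ i, supp σ ≤ supp (τ i)) :
    -ENNReal.log (trExpLog q τ) ≤
      (((σ * mlog σ).trace.re - ∑ i, q i * (σ * mlog (τ i)).trace.re : ℝ) : EReal) := by
  by_cases hq : ∀ i, q i < 0 → posSupp q τ ≤ supp (τ i)
  · have hS : supp σ ≤ posSupp q τ := le_iInf₂ fun i _ => h i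
    have hH := isHermitian_sum_smul_mlog hτ q
    rw [trExpLog_eq hq, ENNReal.log_ofReal_of_pos (trace_expOn_pos hσ hS hH), ← EReal.coe_neg,
      EReal.coe_le_coe_iff, ← trace_mul_sum_smul_re]
    exact neg_log_trace_expOn_le hσ hS hH
  · rw [trExpLog, if_neg hq]
    simp

/-- Only the one-symbol marginals and the total weight matter, so negative weights are harmless. -/
theorem sum_prod_mul_sub (hP : ∑ x, P x = 1) {k : ℕ} {q : Fin k → ℝ} (hq : ∑ i, q i = 1)
    (e : ℝ) (a : X → ℝ) :
    ∑ x : Fin k → X, (∏ i, P (x i)) * (e - ∑ i, q i * a (x i)) = e - ∑ y, P y * a y := by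
  simp only [mul_sub, Finset.sum_sub_distrib, ← Finset.sum_mul, sum_prod_eq_one hP, one_mul,
    Finset.mul_sum]
  rw [Finset.sum_comm]
  have : ∀ i : Fin k, ∑ x : Fin k → X, (∏ i, P (x i)) * (q i * a (x i)) =
      q i * ∑ y, P y * a y := fun i => by
    rw [← sum_prod_mul_apply hP a i, Finset.mul_sum]
    exact Finset.sum_congr rfl fun x _ => by ring
  simp only [this]
  rw [← Finset.sum_mul, hq, one_mul]

theorem lowerUmlaut_le_relEntropy (hρ : ∀ x, IsDensity (ρ x)) (hP : P ∈ stdSimplex ℝ X) {k : ℕ}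
    {q : Fin k → ℝ} (hq : ∑ i, q i = 1) (hσ : IsDensity σ) :
    lowerUmlaut ρ P q ≤ relEntropy (marginalFst (outputState (cqChannel ρ) P) ⊗ₖ σ)
      (outputState (cqChannel ρ) P) := by
  by_cases h : ∀ x, P x ≠ 0 → supp σ ≤ supp (ρ x)
  · rw [relEntropy_output hρ hP.1 hσ h, sum_mul_relEntropy_trace hP.2,
      ← sum_prod_mul_sub hP.2 hq, coe_ereal_sum]
    refine Finset.sum_le_sum fun x _ => ?_
    rw [EReal.coe_mul]
    by_cases hx : ∀ i, P (x i) ≠ 0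
    · refine mul_le_mul_of_nonneg_left ?_
        (EReal.coe_nonneg.2 (Finset.prod_nonneg fun i _ => hP.1 _))
      exact neg_log_trExpLog_le (fun i => (hρ _).1.1) hσ fun i => h _ (hx i)
    -- A tuple containing a symbol of probability zero contributes `0`, even if the trace term is
    -- infinite, because `0 * ±∞ = 0` in `EReal`.
    · push Not at hx
      obtain ⟨i, hi⟩ := hx
      rw [Finset.prod_eq_zero (Finset.mem_univ i) hi]
      simp
  · rw [relEntropy_output_eq_top hρ hP.1 hσ h]
    exact le_top

theorem lowerUmlaut_le_umlaut (hρ : ∀ x, IsDensity (ρ x)) (hP : P ∈ stdSimplex ℝ X) {k : ℕ}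
    {q : Fin k → ℝ} (hq : ∑ i, q i = 1) :
    lowerUmlaut ρ P q ≤ umlaut (outputState (cqChannel ρ) P) :=
  le_iInf₂ fun _ hσ => lowerUmlaut_le_relEntropy hρ hP hq hσ

end LowerBound

/-! ### The rate of convergence for a common support -/

section Rate

variable {X B : Type*} [Fintype X] [DecidableEq X] [Fintype B] [DecidableEq B]
  {ρ : X → Matrix B B ℂ} {P : X → ℝ} {γ σ τ : Matrix B B ℂ}

theorem trace_mul_mlog_nonpos (hσ : IsDensity σ) (hτ : IsDensity τ) :
    (σ * mlog τ).trace.re ≤ 0 := by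
  obtain ⟨U, p, hU, hp⟩ := exists_diagonalizes_nonneg hσ.1
  obtain ⟨V, t, hV, ht⟩ := exists_diagonalizes_nonneg hτ.1
  have hs : ∑ i, t i = 1 := by rw [← hV.trace_re, hτ.2, Complex.one_re]
  rw [hU.trace_mul_re hV.mlog]
  refine Finset.sum_nonpos fun i _ => Finset.sum_nonpos fun j _ => ?_
  refine mul_nonpos_of_nonneg_of_nonpos (overlap_nonneg ..)
    (mul_nonpos_of_nonneg_of_nonpos (hp i) (Real.log_nonpos (ht j) ?_))
  rw [← hs]
  exact Finset.single_le_sum (fun i _ => ht i) (Finset.mem_univ j)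

/-- As `γ` lives on `finSupp ρ P`, the left side is an average of eigenvalues of `finR` whose
eigenvectors lie in that subspace. -/
theorem neg_sum_trace_le_lamFin (hρ : ∀ x, IsDensity (ρ x)) (hγ : IsDensity γ)
    (h : ∀ x, supp γ ≤ supp (ρ x)) [DecidablePred fun x => P x ≠ 0] :
    -∑ x with P x ≠ 0, (γ * mlog (ρ x)).trace.re ≤ lamFin ρ P := by
  classical
  set R : Matrix B B ℂ := -∑ x with P x ≠ 0, mlog (ρ x) with hR
  have hRH : R.IsHermitian := by
    refine IsSelfAdjoint.neg (isSelfAdjoint_sum _ fun x _ => ?_)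
    exact mlog_isHermitian (hρ x).1.1
  have hS : supp γ ≤ finSupp ρ P := le_iInf₂ fun x _ => h x
  obtain ⟨W, κ, e, hκ, he, hj⟩ := exists_diagonalizes_compress (finSupp ρ P) hRH
  have hfin : finR ρ P = compress (finSupp ρ P) R := by
    rw [finR, compress, hR]; congr
  -- Needed because the real `sSup` in `lamFin` is an upper bound only for a bounded set; the set
  -- consists of eigenvalues of one matrix.
  have hbdd : BddAbove {μ : ℝ | ∃ v ∈ finSupp ρ P, v ≠ 0 ∧
      Matrix.toEuclideanLin (finR ρ P) v = (μ : ℂ) • v} := by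
    refine (Set.finite_range κ).bddAbove.mono ?_
    rintro μ ⟨v, -, hv0, hv⟩
    refine hκ.exists_eq_of_mulVec (v := v.ofLp) (fun h0 => hv0 ?_) ?_
    · ext i; simpa using congrFun h0 i
    · rw [← hfin]
      ext i
      simpa using congrArg (fun w : EuclideanSpace ℂ B => w i) hv
  have hle : ∀ j, e j ≠ 0 → κ j ≤ lamFin ρ P := by
    intro j hej
    have hcol := hκ.mulVec_col j
    have hcol' := he.mulVec_col j
    rw [((hj j).resolve_left fun h => hej h.1), Complex.ofReal_one, one_smul] at hcol'
    refine le_csSup hbdd ⟨WithLp.toLp 2 (W *ᵥ Pi.single j 1), ?_, ?_, ?_⟩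
    · rw [← supp_projMatrix (finSupp ρ P), mem_supp_iff]
      exact ⟨_, hcol'⟩
    · intro h0
      have h1 : W *ᵥ Pi.single j 1 = 0 := congrArg WithLp.ofLp h0
      have h2 : (Wᴴ * W) *ᵥ Pi.single j 1 = 0 := by
        rw [← Matrix.mulVec_mulVec, h1, Matrix.mulVec_zero]
      rw [hκ.left, Matrix.one_mulVec] at h2
      simpa using congrFun h2 j
    · rw [hfin]
      ext i
      simpa using congrFun hcol i
  obtain ⟨U, p, hU, hp⟩ := exists_diagonalizes_nonneg hγ.1
  have hs : ∑ i, p i = 1 := by rw [← hU.trace_re, hγ.2, Complex.one_re]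
  have h1 : -∑ x with P x ≠ 0, (γ * mlog (ρ x)).trace.re = (γ * R).trace.re := by
    rw [hR, mul_neg, Matrix.trace_neg, Complex.neg_re, Matrix.mul_sum, Matrix.trace_sum,
      Complex.re_sum]
  rw [h1, ← trace_mul_compress hγ.1.1 hS, hU.trace_mul_re hκ]
  calc _ ≤ ∑ i, ∑ j, overlap U W i j * (p i * lamFin ρ P) := by
        refine Finset.sum_le_sum fun i _ => Finset.sum_le_sum fun j _ => ?_
        rw [← mul_assoc, ← mul_assoc]
        by_cases hej : e j = 0
        · rw [hU.mul_overlap_eq_zero he (hS.trans (supp_projMatrix _).ge) hej, zero_mul, zero_mul]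
        · exact mul_le_mul_of_nonneg_left (hle j hej) (mul_nonneg (overlap_nonneg ..) (hp i))
    _ = lamFin ρ P := by
        rw [hU.sum_sum_overlap_mul_left hκ, ← Finset.sum_mul, hs, one_mul]

/-- All uniform weights are positive and `k ≥ 1`, so `posSupp` is the common support and the Gibbs
state lies in every `supp (ρ y)`, including symbols absent from the tuple. -/
theorem exists_gibbs_tuple (hρ : ∀ x, IsDensity (ρ x)) (hs : ∀ x y, supp (ρ x) = supp (ρ y))
    {k : ℕ} (hk : 1 ≤ k) (x : Fin k → X) :
    ∃ γ, IsDensity γ ∧ (∀ y, supp γ ≤ supp (ρ y)) ∧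
      -ENNReal.log (trExpLog (uniformWeight k) fun i => ρ (x i)) =
        (((γ * mlog γ).trace.re - ∑ i, uniformWeight k i * (γ * mlog (ρ (x i))).trace.re : ℝ) :
          EReal) := by
  have hk0 : (0 : ℝ) < k := by exact_mod_cast hk
  have hq : ∀ i, 0 < uniformWeight k i := fun i => by rw [uniformWeight]; positivity
  let i₀ : Fin k := ⟨0, hk⟩
  have hH := isHermitian_sum_smul_mlog (fun i => (hρ (x i)).1.1) (uniformWeight k)
  have hS : supp (ρ (x i₀)) ≤ posSupp (uniformWeight k) fun i => ρ (x i) :=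
    le_iInf₂ fun i _ => (hs _ _).le
  obtain ⟨γ, hγ, hγS, hγeq⟩ := exists_gibbs (hρ (x i₀)) hS hH
  refine ⟨γ, hγ, fun y => hγS.trans ((iInf₂_le i₀ (hq i₀)).trans (hs _ y).le), ?_⟩
  rw [trExpLog_eq fun i hi => absurd hi (hq i).not_gt,
    ENNReal.log_ofReal_of_pos (trace_expOn_pos (hρ (x i₀)) hS hH), ← EReal.coe_neg, hγeq,
    trace_mul_sum_smul_re]

theorem sum_uniformWeight {k : ℕ} (hk : 1 ≤ k) : ∑ i, uniformWeight k i = 1 := by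
  have hk0 : (k : ℝ) ≠ 0 := by exact_mod_cast (by lia : k ≠ 0)
  simp [uniformWeight, hk0]

/-- Grouping positions by symbol turns uniform weights into the empirical distribution. -/
theorem sum_uniformWeight_mul {k : ℕ} (x : Fin k → X) (a : X → ℝ) :
    ∑ i, uniformWeight k i * a (x i) =
      ∑ y, ((1 / k : ℝ) * ∑ j, if x j = y then 1 else 0) * a y := by
  simp only [Finset.mul_sum, Finset.sum_mul]
  rw [Finset.sum_comm]
  refine Finset.sum_congr rfl fun i _ => ?_
  rw [Finset.sum_eq_single (x i)]
  · simp [uniformWeight]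
  · intro y _ hy
    simp [Ne.symm hy]
  · simp

theorem umlaut_nonneg (hρ : ∀ x, IsDensity (ρ x)) (hP : P ∈ stdSimplex ℝ X) :
    0 ≤ umlaut (outputState (cqChannel ρ) P) := by
  refine le_iInf₂ fun σ hσ => ?_
  by_cases h : ∀ x, P x ≠ 0 → supp σ ≤ supp (ρ x)
  · rw [relEntropy_output hρ hP.1 hσ h]
    refine EReal.coe_nonneg.2 (Finset.sum_nonneg fun x _ => ?_)
    by_cases hx : P x = 0
    · simp [hx]
    · exact mul_nonneg (hP.1 x) (relEntropy_trace_nonneg hσ (hρ x) (h x hx))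
  · rw [relEntropy_output_eq_top hρ hP.1 hσ h]
    exact le_top

theorem nonempty_of_mem_stdSimplex (hP : P ∈ stdSimplex ℝ X) : ∃ x, P x ≠ 0 := by
  by_contra! h
  simpa [h] using hP.2

theorem umlaut_le_of_supp_le (hρ : ∀ x, IsDensity (ρ x)) (hP : P ∈ stdSimplex ℝ X)
    (hσ : IsDensity σ) (h : ∀ x, supp σ ≤ supp (ρ x)) :
    umlaut (outputState (cqChannel ρ) P) ≤
      (((σ * mlog σ).trace.re - ∑ x, P x * (σ * mlog (ρ x)).trace.re : ℝ) : EReal) := by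
  rw [← sum_mul_relEntropy_trace hP.2, ← relEntropy_output hρ hP.1 hσ fun x _ => h x]
  exact iInf₂_le σ hσ

theorem exists_umlaut_eq_coe (hρ : ∀ x, IsDensity (ρ x)) (hs : ∀ x y, supp (ρ x) = supp (ρ y))
    (hP : P ∈ stdSimplex ℝ X) :
    ∃ u : ℝ, 0 ≤ u ∧ umlaut (outputState (cqChannel ρ) P) = (u : EReal) := by
  obtain ⟨x₀, -⟩ := nonempty_of_mem_stdSimplex hP
  have h1 := umlaut_le_of_supp_le hρ hP (hρ x₀) fun y => (hs x₀ y).le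
  have h0 := umlaut_nonneg hρ hP
  have h2 := EReal.coe_toReal (ne_top_of_le_ne_top (EReal.coe_ne_top _) h1)
    (ne_bot_of_le_ne_bot EReal.zero_ne_bot h0)
  exact ⟨_, EReal.toReal_nonneg h0, h2.symm⟩

theorem lamFin_nonneg (hρ : ∀ x, IsDensity (ρ x)) (hs : ∀ x y, supp (ρ x) = supp (ρ y))
    (hP : P ∈ stdSimplex ℝ X) : 0 ≤ lamFin ρ P := by
  classical
  obtain ⟨x₀, -⟩ := nonempty_of_mem_stdSimplex hP
  refine le_trans ?_ (neg_sum_trace_le_lamFin (P := P) hρ (hρ x₀) fun y => (hs x₀ y).le)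
  rw [neg_nonneg]
  exact Finset.sum_nonpos fun x _ => trace_mul_mlog_nonpos (hρ x₀) (hρ x)

/-- The one-parameter family of estimates behind the rate of convergence. -/
theorem exists_lowerUmlaut_eq_coe (hρ : ∀ x, IsDensity (ρ x))
    (hs : ∀ x y, supp (ρ x) = supp (ρ y)) (hP : P ∈ stdSimplex ℝ X) {u : ℝ} (hu0 : 0 ≤ u)
    (hu : umlaut (outputState (cqChannel ρ) P) = (u : EReal)) {k : ℕ} (hk : 1 ≤ k) :
    ∃ l : ℝ, lowerUmlaut ρ P (uniformWeight k) = (l : EReal) ∧ l ≤ u ∧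
      ∀ c : ℝ, 0 < c → u - l ≤ 1 / (k * c ^ 2) * u + c * lamFin ρ P := by
  classical
  choose γ hγ hγs hγeq using exists_gibbs_tuple hρ hs hk
  set f : (Fin k → X) → ℝ := fun x => (γ x * mlog (γ x)).trace.re -
    ∑ i, uniformWeight k i * (γ x * mlog (ρ (x i))).trace.re with hf
  have hl : lowerUmlaut ρ P (uniformWeight k) =
      ((∑ x : Fin k → X, (∏ i, P (x i)) * f x : ℝ) : EReal) := by
    rw [lowerUmlaut, coe_ereal_sum]
    exact Finset.sum_congr rfl fun x _ => by rw [hγeq, EReal.coe_mul]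
  refine ⟨_, hl, ?_, fun c hc => ?_⟩
  · rw [← EReal.coe_le_coe_iff, ← hl, ← hu]
    exact lowerUmlaut_le_umlaut hρ hP (sum_uniformWeight hk)
  have hlam := lamFin_nonneg hρ hs hP
  have hk0 : (0 : ℝ) < k := by exact_mod_cast hk
  have hprod : ∀ x : Fin k → X, 0 ≤ ∏ i, P (x i) := fun x =>
    Finset.prod_nonneg fun i _ => hP.1 _
  -- The summand is an average of the relative entropies of `γ x` to the `ρ (x i)`.
  have hf0 : ∀ x, 0 ≤ f x := fun x => by
    have : f x = ∑ i, uniformWeight k i *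
        (γ x * (mlog (γ x) - mlog (ρ (x i)))).trace.re := by
      simp only [hf, mul_sub, Matrix.trace_sub, Complex.sub_re, Finset.sum_sub_distrib]
      rw [← Finset.sum_mul, sum_uniformWeight hk, one_mul]
    rw [this]
    refine Finset.sum_nonneg fun i _ => mul_nonneg ?_
      (relEntropy_trace_nonneg (hγ x) (hρ _) (hγs x _))
    rw [uniformWeight]; positivity
  set T : (Fin k → X) → X → ℝ := fun x y => (1 / k : ℝ) * ∑ j, if x j = y then 1 else 0
  have hT0 : ∀ x y, 0 ≤ T x y := fun x y => mul_nonneg (by positivity)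
    (Finset.sum_nonneg fun j _ => by split_ifs <;> norm_num)
  -- For a typical tuple, `γ x` is a competitor in the minimum `u`. Replacing `T` by `P` costs at
  -- most `c` on each symbol of `supp P`, hence `c * lamFin ρ P` in total. Symbols outside `supp P`
  -- only help, by the sign of `Tr γ log ρ_y`.
  have hgood : ∀ x, (∀ y, P y - c ≤ T x y) → u - c * lamFin ρ P ≤ f x := by
    intro x hx
    have h1 : u ≤ (γ x * mlog (γ x)).trace.re - ∑ y, P y * (γ x * mlog (ρ y)).trace.re := by
      rw [← EReal.coe_le_coe_iff, ← hu]
      exact umlaut_le_of_supp_le hρ hP (hγ x) (hγs x)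
    have h2 := mul_le_mul_of_nonneg_left
      (neg_sum_trace_le_lamFin (P := P) hρ (hγ x) (hγs x)) hc.le
    have h3 : f x = (γ x * mlog (γ x)).trace.re - ∑ y, T x y * (γ x * mlog (ρ y)).trace.re := by
      simp only [hf, T]
      rw [sum_uniformWeight_mul x fun y => (γ x * mlog (ρ y)).trace.re]
    have h4 : ∑ y, T x y * (γ x * mlog (ρ y)).trace.re ≤
        ∑ y, P y * (γ x * mlog (ρ y)).trace.re -
          c * ∑ y with P y ≠ 0, (γ x * mlog (ρ y)).trace.re := by
      rw [Finset.sum_filter, Finset.mul_sum, ← Finset.sum_sub_distrib]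
      refine Finset.sum_le_sum fun y _ => ?_
      have ha := trace_mul_mlog_nonpos (hγ x) (hρ y)
      split_ifs with hy
      · rw [← sub_mul]
        exact mul_le_mul_of_nonpos_right (hx y) ha
      · push Not at hy
        rw [hy, zero_mul, mul_zero, sub_zero]
        exact mul_nonpos_of_nonneg_of_nonpos (hT0 x y) ha
    rw [mul_neg] at h2
    linarith
  have hcheb := sum_prod_ite_le hP hk hc (fun x => ¬ ∀ y, P y - c ≤ T x y) fun x hx => by
    push Not at hx
    exact hx
  -- A bad tuple loses at most `u`, since `f` is nonnegative.
  have hpt : ∀ x : Fin k → X, (∏ i, P (x i)) * (u - f x) ≤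
      (if ¬ ∀ y, P y - c ≤ T x y then ∏ i, P (x i) else 0) * u +
        (∏ i, P (x i)) * (c * lamFin ρ P) := by
    intro x
    have hcl : 0 ≤ (∏ i, P (x i)) * (c * lamFin ρ P) :=
      mul_nonneg (hprod x) (mul_nonneg hc.le hlam)
    by_cases hx : ∀ y, P y - c ≤ T x y
    · rw [if_neg (not_not.2 hx), zero_mul, zero_add]
      exact mul_le_mul_of_nonneg_left (by linarith [hgood x hx]) (hprod x)
    · rw [if_pos hx]
      have := mul_le_mul_of_nonneg_left (by linarith [hf0 x] : u - f x ≤ u) (hprod x)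
      linarith
  have hsum := Finset.sum_le_sum fun x (_ : x ∈ Finset.univ) => hpt x
  rw [Finset.sum_add_distrib, ← Finset.sum_mul, ← Finset.sum_mul, sum_prod_eq_one hP.2,
    one_mul] at hsum
  simp only [mul_sub, Finset.sum_sub_distrib] at hsum
  rw [← Finset.sum_mul, sum_prod_eq_one hP.2, one_mul] at hsum
  exact hsum.trans (add_le_add_left (mul_le_mul_of_nonneg_right hcheb hu0) _)

theorem pMin_pos (hP : P ∈ stdSimplex ℝ X) : 0 < pMin P := by
  obtain ⟨x₀, hx₀⟩ := nonempty_of_mem_stdSimplex hP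
  have hfin : {p : ℝ | ∃ x, P x ≠ 0 ∧ p = P x}.Finite := by
    refine (Set.finite_range P).subset ?_
    rintro p ⟨x, -, rfl⟩
    exact ⟨x, rfl⟩
  have hne : {p : ℝ | ∃ x, P x ≠ 0 ∧ p = P x}.Nonempty := ⟨P x₀, x₀, hx₀, rfl⟩
  obtain ⟨x, hx, hxp⟩ := hne.csInf_mem hfin
  rw [pMin, hxp]
  exact (hP.1 x).lt_of_ne' hx

/-- `pStar` minimizes the right-hand side over `c` when `u` and `lam` are positive; there the first
term is half the second. If `u` or `lam` vanishes, `pStar` is `0` (with `x / 0 = 0`) and is not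
admissible, so small or large `c` are used to show `d ≤ 0`. -/
theorem le_rateBound {k : ℕ} (hk : 1 ≤ k) {d u lam pmin : ℝ} (hu : 0 ≤ u) (hlam : 0 ≤ lam)
    (hp : 0 < pmin) (h : ∀ c : ℝ, 0 < c → d ≤ 1 / (k * c ^ 2) * u + c * lam) :
    d ≤ rateBound k u lam pmin := by
  have hk0 : (0 : ℝ) < k := by exact_mod_cast hk
  have hk1 : (1 : ℝ) ≤ k := by exact_mod_cast hk
  rw [rateBound]
  split_ifs with hlt
  swap
  · exact h pmin hp
  rcases hu.eq_or_lt with rfl | hu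
  · have hR : 3 / (k : ℝ) ^ (1 / 3 : ℝ) * (1 / 2 * (0 : ℝ) ^ (1 / 2 : ℝ) * lam) ^ (2 / 3 : ℝ) =
        0 := by
      rw [Real.zero_rpow (by norm_num), mul_zero, zero_mul, Real.zero_rpow (by norm_num), mul_zero]
    rw [hR]
    by_contra! hd
    have h1 := h (d / (2 * (lam + 1))) (by positivity)
    rw [mul_zero, zero_add, div_mul_eq_mul_div, le_div_iff₀ (by positivity)] at h1
    nlinarith
  rcases hlam.eq_or_lt with rfl | hlam
  · rw [mul_zero, Real.zero_rpow (by norm_num), mul_zero]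
    by_contra! hd
    -- A `c` large enough that `d k c² ≥ d c = d + u > u`, contradicting the hypothesis.
    have h1 := h (1 + u / d) (by positivity)
    have hc : 1 ≤ 1 + u / d := by linarith [div_pos hu hd]
    rw [mul_zero, add_zero, one_div_mul_eq_div, le_div_iff₀ (by positivity)] at h1
    have h2 : (1 + u / d) ≤ k * (1 + u / d) ^ 2 := by nlinarith
    have h3 := mul_le_mul_of_nonneg_left h2 hd.le
    have h4 : d * (1 + u / d) = d + u := by field_simp
    linarith
  set c := pStar k u lam with hcdef
  have hc : 0 < c := by rw [hcdef, pStar]; positivity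
  have hcube : ∀ {y : ℝ}, 0 ≤ y → (y ^ (1 / 3 : ℝ)) ^ 3 = y := fun {y} hy => by
    rw [← Real.rpow_natCast, ← Real.rpow_mul hy]; norm_num
  have hc3 : c ^ 3 = 2 * u / (k * lam) := by
    rw [hcdef, pStar, mul_pow, div_pow, hcube hk0.le, hcube (by positivity)]
    field_simp
  have h1 : 1 / (k * c ^ 2) * u + c * lam = 3 / 2 * (c * lam) := by
    have : k * lam * c ^ 3 = 2 * u := by rw [hc3]; field_simp
    have h2 : 1 / (k * c ^ 2) * u = c * lam / 2 := by
      rw [one_div_mul_eq_div, div_eq_div_iff (by positivity) (by norm_num)]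
      linear_combination -this
    rw [h2]; ring
  refine (h c hc).trans_eq ?_
  rw [h1]
  have h23 : ∀ {y : ℝ}, 0 ≤ y → (y ^ (2 / 3 : ℝ)) ^ 3 = y ^ 2 := fun {y} hy => by
    rw [← Real.rpow_natCast, ← Real.rpow_mul hy, ← Real.rpow_natCast y 2]; norm_num
  have h12 : (u ^ (1 / 2 : ℝ)) ^ 2 = u := by
    rw [← Real.rpow_natCast, ← Real.rpow_mul hu.le]; norm_num
  -- Cubing both sides removes all fractional exponents.
  rw [← pow_left_inj₀ (by positivity) (by positivity) (three_ne_zero), mul_pow, mul_pow c, hc3,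
    mul_pow (3 / (k : ℝ) ^ (1 / 3 : ℝ)), div_pow 3 ((k : ℝ) ^ (1 / 3 : ℝ)), hcube hk0.le,
    h23 (by positivity), mul_pow, mul_pow (1 / 2), h12]
  field_simp

/-- The choice `c = k^{-1/3}` makes both error terms of order `k^{-1/3}`. -/
theorem tendsto_lowerUmlaut (hρ : ∀ x, IsDensity (ρ x)) (hs : ∀ x y, supp (ρ x) = supp (ρ y))
    (hP : P ∈ stdSimplex ℝ X) :
    Tendsto (fun k : ℕ => lowerUmlaut ρ P (uniformWeight k)) atTop
      (𝓝 (umlaut (outputState (cqChannel ρ) P))) := by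
  obtain ⟨u, hu0, hu⟩ := exists_umlaut_eq_coe hρ hs hP
  choose! l hl hlu hlc using fun (k : ℕ) (hk : 1 ≤ k) =>
    exists_lowerUmlaut_eq_coe hρ hs hP hu0 hu hk
  rw [hu]
  have hlim : Tendsto (fun k : ℕ => u - (u + lamFin ρ P) * (k : ℝ) ^ (-(1 / 3) : ℝ)) atTop
      (𝓝 u) := by
    have := ((tendsto_rpow_neg_atTop (by norm_num : (0 : ℝ) < 1 / 3)).comp
      tendsto_natCast_atTop_atTop).const_mul (u + lamFin ρ P)
    simpa using this.const_sub u
  have hreal : Tendsto l atTop (𝓝 u) := by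
    refine tendsto_of_tendsto_of_tendsto_of_le_of_le' hlim tendsto_const_nhds ?_ ?_
    · filter_upwards [eventually_ge_atTop 1] with k hk
      have hk0 : (0 : ℝ) < k := by exact_mod_cast hk
      have h1 := hlc k hk ((k : ℝ) ^ (-(1 / 3) : ℝ)) (by positivity)
      have h2 : 1 / ((k : ℝ) * ((k : ℝ) ^ (-(1 / 3) : ℝ)) ^ 2) = (k : ℝ) ^ (-(1 / 3) : ℝ) := by
        rw [← Real.rpow_natCast, ← Real.rpow_mul hk0.le]
        conv_lhs => enter [2, 1]; rw [← Real.rpow_one (k : ℝ)]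
        rw [← Real.rpow_add hk0, one_div, ← Real.rpow_neg hk0.le]
        norm_num
      rw [h2] at h1
      linarith
    · filter_upwards [eventually_ge_atTop 1] with k hk using hlu k hk
  refine ((continuous_coe_real_ereal.tendsto u).comp hreal).congr' ?_
  filter_upwards [eventually_ge_atTop 1] with k hk using (hl k hk).symm

end Rate

/-! ### Joint convexity of the relative entropy -/

section JointConvexity

variable {n : Type*} [Fintype n] [DecidableEq n] {a b U V : Matrix n n ℂ} {p t : n → ℝ}

/-- A functional, linear in `(a, b)`, whose maximum over `Z` is `∑ᵢⱼ cᵢⱼ pᵢ² / (tⱼ + s pᵢ)`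
in spectral coordinates of `a` and `b`. -/
noncomputable def resolventForm (s : ℝ) (Z a b : Matrix n n ℂ) : ℝ :=
  2 * (Zᴴ * a).trace.re - (Zᴴ * b * Z).trace.re - s * (Z * a * Zᴴ).trace.re

/-- Linearity is what makes the maximum over `Z` subadditive in the pair `(a, b)`. -/
theorem resolventForm_sum {ι : Type*} [Fintype ι] (s : ℝ) (Z : Matrix n n ℂ)
    (a b : ι → Matrix n n ℂ) :
    resolventForm s Z (∑ x, a x) (∑ x, b x) = ∑ x, resolventForm s Z (a x) (b x) := by
  simp only [resolventForm, Matrix.mul_sum, Matrix.sum_mul, Matrix.trace_sum, Complex.re_sum,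
    Finset.sum_sub_distrib]
  rw [Finset.mul_sum, Finset.mul_sum]

/-- The value of `resolventForm` in spectral coordinates. -/
theorem Diagonalizes.resolventForm_eq (hU : Diagonalizes U a p) (hV : Diagonalizes V b t) (s : ℝ)
    (Y : Matrix n n ℂ) :
    resolventForm s (V * Y * Uᴴ) a b = ∑ i, ∑ j,
      (2 * p i * (Y j i * (Uᴴ * V) i j).re - (t j + s * p i) * Complex.normSq (Y j i)) := by
  have h1 : ((V * Y * Uᴴ)ᴴ * a).trace.re = ∑ i, ∑ j, p i * (Y j i * (Uᴴ * V) i j).re := by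
    have : ((V * Y * Uᴴ)ᴴ * a).trace =
        ((Matrix.diagonal (fun i => (p i : ℂ)) * Yᴴ) * (Uᴴ * V)ᴴ).trace := by
      rw [hU.eq]
      simp only [Matrix.conjTranspose_mul, Matrix.conjTranspose_conjTranspose]
      calc _ = (U * (Yᴴ * Vᴴ * U * Matrix.diagonal (fun i => (p i : ℂ)) * Uᴴ)).trace := by
            simp only [mul_assoc]
        _ = (Yᴴ * Vᴴ * U * Matrix.diagonal (fun i => (p i : ℂ)) * (Uᴴ * U)).trace := by
            rw [Matrix.trace_mul_comm]; simp only [mul_assoc]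
        _ = _ := by
            rw [hU.left, mul_one, Matrix.trace_mul_comm]; simp only [mul_assoc]
    rw [this, Matrix.trace, Complex.re_sum]
    refine Finset.sum_congr rfl fun i _ => ?_
    rw [Matrix.diag_apply, Matrix.mul_apply, Complex.re_sum]
    refine Finset.sum_congr rfl fun j _ => ?_
    rw [Matrix.diagonal_mul, Matrix.conjTranspose_apply, Matrix.conjTranspose_apply, mul_assoc,
      Complex.re_ofReal_mul, ← star_mul', RCLike.star_def, Complex.conj_re]
  have h2 : ((V * Y * Uᴴ)ᴴ * b * (V * Y * Uᴴ)).trace.re =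
      ∑ i, ∑ j, t j * Complex.normSq (Y j i) := by
    have : ((V * Y * Uᴴ)ᴴ * b * (V * Y * Uᴴ)).trace =
        (Yᴴ * (Matrix.diagonal (fun i => (t i : ℂ)) * Y)).trace := by
      rw [hV.eq]
      simp only [Matrix.conjTranspose_mul, Matrix.conjTranspose_conjTranspose]
      calc _ = (U * (Yᴴ * (Vᴴ * V) * Matrix.diagonal (fun i => (t i : ℂ)) * (Vᴴ * V) * Y *
            Uᴴ)).trace := by simp only [mul_assoc]
        _ = (Yᴴ * Matrix.diagonal (fun i => (t i : ℂ)) * Y * (Uᴴ * U)).trace := by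
            rw [Matrix.trace_mul_comm, hV.left]; simp only [mul_assoc, mul_one]
        _ = _ := by rw [hU.left, mul_one, mul_assoc]
    rw [this, Matrix.trace, Complex.re_sum]
    refine Finset.sum_congr rfl fun i _ => ?_
    rw [Matrix.diag_apply, Matrix.mul_apply, Complex.re_sum]
    refine Finset.sum_congr rfl fun j _ => ?_
    rw [Matrix.diagonal_mul, Matrix.conjTranspose_apply, RCLike.star_def]
    have : (starRingEnd ℂ) (Y j i) * ((t j : ℂ) * Y j i) =
        ((t j * Complex.normSq (Y j i) : ℝ) : ℂ) := by
      push_cast; rw [Complex.normSq_eq_conj_mul_self]; ring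
    rw [this, Complex.ofReal_re]
  have h3 : ((V * Y * Uᴴ) * a * (V * Y * Uᴴ)ᴴ).trace.re =
      ∑ i, ∑ j, p i * Complex.normSq (Y j i) := by
    have : ((V * Y * Uᴴ) * a * (V * Y * Uᴴ)ᴴ).trace =
        (Y * (Matrix.diagonal (fun i => (p i : ℂ)) * Yᴴ)).trace := by
      rw [hU.eq]
      simp only [Matrix.conjTranspose_mul, Matrix.conjTranspose_conjTranspose]
      calc _ = (V * (Y * (Uᴴ * U) * Matrix.diagonal (fun i => (p i : ℂ)) * (Uᴴ * U) * Yᴴ *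
            Vᴴ)).trace := by simp only [mul_assoc]
        _ = (Y * Matrix.diagonal (fun i => (p i : ℂ)) * Yᴴ * (Vᴴ * V)).trace := by
            rw [Matrix.trace_mul_comm, hU.left]; simp only [mul_assoc, mul_one]
        _ = _ := by rw [hV.left, mul_one, mul_assoc]
    rw [this, Matrix.trace, Complex.re_sum, Finset.sum_comm]
    refine Finset.sum_congr rfl fun j _ => ?_
    rw [Matrix.diag_apply, Matrix.mul_apply, Complex.re_sum]
    refine Finset.sum_congr rfl fun i _ => ?_
    rw [Matrix.diagonal_mul, Matrix.conjTranspose_apply, RCLike.star_def]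
    have : Y j i * ((p i : ℂ) * (starRingEnd ℂ) (Y j i)) =
        ((p i * Complex.normSq (Y j i) : ℝ) : ℂ) := by
      push_cast; rw [Complex.normSq_eq_conj_mul_self]; ring
    rw [this, Complex.ofReal_re]
  rw [resolventForm, h1, h2, h3]
  simp only [Finset.mul_sum, ← Finset.sum_sub_distrib]
  exact Finset.sum_congr rfl fun i _ => Finset.sum_congr rfl fun j _ => by ring

/-- The form decouples over the entries `y` of `Vᴴ * Z * U`, and completing the square in each gives
the bound. -/
theorem Diagonalizes.resolventForm_le (hU : Diagonalizes U a p) (hV : Diagonalizes V b t)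
    (hp : ∀ i, 0 ≤ p i) (ht : ∀ j, 0 ≤ t j) {s : ℝ} (hs : 0 < s) (Z : Matrix n n ℂ) :
    resolventForm s Z a b ≤ ∑ i, ∑ j, overlap U V i j * (p i ^ 2 / (t j + s * p i)) := by
  have hZ : Z = V * (Vᴴ * Z * U) * Uᴴ := by
    calc Z = (V * Vᴴ) * Z * (U * Uᴴ) := by rw [hV.right, hU.right, one_mul, mul_one]
      _ = _ := by simp only [mul_assoc]
  rw [hZ, hU.resolventForm_eq hV]
  refine Finset.sum_le_sum fun i _ => Finset.sum_le_sum fun j _ => ?_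
  set y := (Vᴴ * Z * U) j i
  set c := (Uᴴ * V) i j with hc
  rw [overlap, ← hc]
  rcases (hp i).eq_or_lt with h0 | h0
  · rw [← h0]
    simp only [mul_zero, zero_mul, zero_sub, add_zero, ne_eq, OfNat.ofNat_ne_zero,
      not_false_eq_true, zero_pow, zero_div]
    exact neg_nonpos.2 (mul_nonneg (ht j) (Complex.normSq_nonneg _))
  have hd : 0 < t j + s * p i := by have := ht j; positivity
  rw [mul_div_assoc', le_div_iff₀ hd]
  simp only [Complex.mul_re, Complex.normSq_apply]
  nlinarith [sq_nonneg ((t j + s * p i) * y.re - p i * c.re),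
    sq_nonneg ((t j + s * p i) * y.im + p i * c.im)]

/-- The witness has the entries `p c̄ / (t + s p)` at which the completed squares vanish. -/
theorem Diagonalizes.exists_resolventForm_eq (hU : Diagonalizes U a p) (hV : Diagonalizes V b t)
    (hp : ∀ i, 0 ≤ p i) (ht : ∀ j, 0 ≤ t j) {s : ℝ} (hs : 0 < s) :
    ∃ Z, resolventForm s Z a b = ∑ i, ∑ j, overlap U V i j * (p i ^ 2 / (t j + s * p i)) := by
  refine ⟨V * (Matrix.of fun j i => ((p i / (t j + s * p i) : ℝ) : ℂ) *
    (starRingEnd ℂ) ((Uᴴ * V) i j)) * Uᴴ, ?_⟩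
  rw [hU.resolventForm_eq hV]
  refine Finset.sum_congr rfl fun i _ => Finset.sum_congr rfl fun j _ => ?_
  rw [Matrix.of_apply, overlap]
  set c := (Uᴴ * V) i j
  rcases (hp i).eq_or_lt with h0 | h0
  · simp [← h0]
  have hd : 0 < t j + s * p i := by have := ht j; positivity
  rw [mul_assoc (((p i / (t j + s * p i) : ℝ) : ℂ)), ← Complex.normSq_eq_conj_mul_self,
    ← Complex.ofReal_mul, Complex.ofReal_re, map_mul, Complex.normSq_conj, Complex.normSq_ofReal]
  field_simp
  ring

/-- The primitive in `s` of `∑ᵢⱼ cᵢⱼ pᵢ² / (tⱼ + s pᵢ)`. -/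
noncomputable def logForm (U V : Matrix n n ℂ) (p t : n → ℝ) (s : ℝ) : ℝ :=
  ∑ i, ∑ j, overlap U V i j * (p i * (Real.log (t j + s * p i) - Real.log (t j)))

theorem Diagonalizes.hasDerivAt_logForm (hU : Diagonalizes U a p) (hV : Diagonalizes V b t)
    (hp : ∀ i, 0 ≤ p i) (ht : ∀ j, 0 ≤ t j) (h : supp a ≤ supp b) {s : ℝ} (hs : 0 ≤ s) :
    HasDerivAt (logForm U V p t) (∑ i, ∑ j, overlap U V i j * (p i ^ 2 / (t j + s * p i))) s := by
  refine HasDerivAt.fun_sum fun i _ => HasDerivAt.fun_sum fun j _ => ?_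
  by_cases hc : overlap U V i j * p i = 0
  · rcases mul_eq_zero.1 hc with h0 | h0
    · simpa [h0] using hasDerivAt_const s (0 : ℝ)
    · simpa [h0] using hasDerivAt_const s (0 : ℝ)
  have htj : 0 < t j := (ht j).lt_of_ne' fun h0 => hc (hU.mul_overlap_eq_zero hV h h0)
  have hd : t j + s * p i ≠ 0 := by have := hp i; positivity
  have h1 : HasDerivAt (fun s => t j + s * p i) (p i) s := by
    simpa using ((hasDerivAt_id s).mul_const (p i)).const_add (t j)
  have h2 := (((h1.log hd).sub_const (Real.log (t j))).const_mul (p i)).const_mul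
    (overlap U V i j)
  exact h2.congr_deriv (by ring)

/-- Subtracting `p log s` turns `p log (t + s p)` into `p log (t / s + p)`, which tends to `p log
p`; the subtracted terms add up to `Tr a · log s`. -/
theorem Diagonalizes.tendsto_logForm (hU : Diagonalizes U a p) (hV : Diagonalizes V b t)
    (hp : ∀ i, 0 ≤ p i) (ht : ∀ j, 0 ≤ t j) :
    Tendsto (fun s => logForm U V p t s - a.trace.re * Real.log s) atTop
      (𝓝 (a * (Umlaut.mlog a - Umlaut.mlog b)).trace.re) := by
  have heq : ∀ s, logForm U V p t s - a.trace.re * Real.log s = ∑ i, ∑ j, overlap U V i j *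
      (p i * (Real.log (t j + s * p i) - Real.log s - Real.log (t j))) := by
    intro s
    rw [hU.trace_re, Finset.sum_mul, ← hU.sum_sum_overlap_mul_left hV, logForm,
      ← Finset.sum_sub_distrib]
    refine Finset.sum_congr rfl fun i _ => ?_
    rw [← Finset.sum_sub_distrib]
    exact Finset.sum_congr rfl fun j _ => by ring
  simp only [heq]
  rw [hU.trace_relEntropy hV]
  refine tendsto_finsetSum _ fun i _ => tendsto_finsetSum _ fun j _ => ?_
  by_cases hc : overlap U V i j * p i = 0
  · rcases mul_eq_zero.1 hc with h0 | h0 <;> simp [h0]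
  have hpi : 0 < p i := (hp i).lt_of_ne' (right_ne_zero_of_mul hc)
  refine Tendsto.const_mul _ (Tendsto.const_mul _ (Tendsto.sub_const ?_ _))
  have h1 : Tendsto (fun s : ℝ => t j / s + p i) atTop (𝓝 (p i)) := by
    simpa using (tendsto_const_nhds.div_atTop (tendsto_id (α := ℝ) (x := atTop))).add_const (p i)
  refine (((Real.continuousAt_log hpi.ne').tendsto).comp h1).congr' ?_
  filter_upwards [eventually_gt_atTop 0] with s hs
  have hd : t j + s * p i ≠ 0 := by have := ht j; positivity
  rw [Function.comp_apply, ← Real.log_div hd hs.ne']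
  congr 1
  field_simp

/-- **Joint convexity** of the relative entropy, in its homogeneous form. -/
theorem relEntropy_trace_sum_le {ι : Type*} [Fintype ι] {a b : ι → Matrix n n ℂ}
    (ha : ∀ x, (a x).PosSemidef) (hb : ∀ x, (b x).PosSemidef) (h : ∀ x, supp (a x) ≤ supp (b x))
    (hs : supp (∑ x, a x) ≤ supp (∑ x, b x)) :
    ((∑ x, a x) * (mlog (∑ x, a x) - mlog (∑ x, b x))).trace.re ≤
      ∑ x, (a x * (mlog (a x) - mlog (b x))).trace.re := by
  choose U p hU hp using fun x => exists_diagonalizes_nonneg (ha x)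
  choose V t hV ht using fun x => exists_diagonalizes_nonneg (hb x)
  obtain ⟨U₀, p₀, hU₀, hp₀⟩ :=
    exists_diagonalizes_nonneg (Matrix.posSemidef_sum Finset.univ fun x _ => ha x)
  obtain ⟨V₀, t₀, hV₀, ht₀⟩ :=
    exists_diagonalizes_nonneg (Matrix.posSemidef_sum Finset.univ fun x _ => hb x)
  set φ : ℝ → ℝ := fun s => ∑ x, logForm (U x) (V x) (p x) (t x) s - logForm U₀ V₀ p₀ t₀ s
    with hφ
  have hder : ∀ s, 0 ≤ s → HasDerivAt φ (∑ x, (∑ i, ∑ j, overlap (U x) (V x) i j *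
      (p x i ^ 2 / (t x j + s * p x i))) -
        ∑ i, ∑ j, overlap U₀ V₀ i j * (p₀ i ^ 2 / (t₀ j + s * p₀ i))) s := fun s hs' =>
    (HasDerivAt.fun_sum fun x _ =>
      (hU x).hasDerivAt_logForm (hV x) (hp x) (ht x) (h x) hs').sub
      (hU₀.hasDerivAt_logForm hV₀ hp₀ ht₀ hs hs')
  -- The optimal `Z` for the sums is a trial point for every summand, so the derivative of `φ` is
  -- nonnegative.
  have hmono : MonotoneOn φ (Set.Ici 0) := by
    refine monotoneOn_of_deriv_nonneg (convex_Ici 0)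
      (fun s hs' => (hder s hs').continuousAt.continuousWithinAt) ?_ ?_
    · intro s hs'
      rw [interior_Ici] at hs'
      exact (hder s (le_of_lt hs')).differentiableAt.differentiableWithinAt
    · intro s hs'
      rw [interior_Ici] at hs'
      rw [(hder s (le_of_lt hs')).deriv, sub_nonneg]
      obtain ⟨Z, hZ⟩ := hU₀.exists_resolventForm_eq hV₀ hp₀ ht₀ hs'
      rw [← hZ, resolventForm_sum]
      exact Finset.sum_le_sum fun x _ => (hU x).resolventForm_le (hV x) (hp x) (ht x) hs' Z
  have h0 : φ 0 = 0 := by simp [hφ, logForm]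
  have htr : (∑ x, a x).trace.re = ∑ x, (a x).trace.re := by
    rw [Matrix.trace_sum, Complex.re_sum]
  -- The divergent `log s` terms cancel because the trace is additive.
  have hlim : Tendsto φ atTop (𝓝 (∑ x, (a x * (mlog (a x) - mlog (b x))).trace.re -
      ((∑ x, a x) * (mlog (∑ x, a x) - mlog (∑ x, b x))).trace.re)) := by
    refine ((tendsto_finsetSum Finset.univ fun x _ =>
      (hU x).tendsto_logForm (hV x) (hp x) (ht x)).sub
      (hU₀.tendsto_logForm hV₀ hp₀ ht₀)).congr fun s => ?_
    rw [htr, Finset.sum_sub_distrib, Finset.sum_mul, hφ]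
    ring
  rw [← sub_nonneg]
  refine ge_of_tendsto hlim ?_
  filter_upwards [eventually_ge_atTop 0] with s hs'
  rw [← h0]
  exact hmono Set.self_mem_Ici hs' hs'

end JointConvexity

/-! ### The umlaut information of a classical-quantum channel -/

section Kronecker

variable {m n : Type*} [Fintype m] [DecidableEq m] [Fintype n] [DecidableEq n]
  {Ψ U : Matrix m m ℂ} {σ τ V W : Matrix n n ℂ} {r : m → ℝ} {p t : n → ℝ}

theorem Diagonalizes.kronecker (hU : Diagonalizes U Ψ r) (hV : Diagonalizes V σ p) :
    Diagonalizes (U ⊗ₖ V) (Ψ ⊗ₖ σ) fun x => r x.1 * p x.2 := by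
  refine ⟨?_, ?_, ?_⟩
  · rw [Matrix.conjTranspose_kronecker, ← Matrix.mul_kronecker_mul, hU.left, hV.left,
      Matrix.one_kronecker_one]
  · rw [Matrix.conjTranspose_kronecker, ← Matrix.mul_kronecker_mul, hU.right, hV.right,
      Matrix.one_kronecker_one]
  · have : (Matrix.diagonal fun x : m × n => ((r x.1 * p x.2 : ℝ) : ℂ)) =
        Matrix.diagonal (fun i => (r i : ℂ)) ⊗ₖ Matrix.diagonal (fun j => (p j : ℂ)) := by
      rw [Matrix.diagonal_kronecker_diagonal]; simp
    rw [this, Matrix.conjTranspose_kronecker, ← Matrix.mul_kronecker_mul,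
      ← Matrix.mul_kronecker_mul, ← hU.eq, ← hV.eq]

theorem overlap_kronecker (hU : Uᴴ * U = 1) (x y : m × n) :
    overlap (U ⊗ₖ V) (U ⊗ₖ W) x y = if x.1 = y.1 then overlap V W x.2 y.2 else 0 := by
  rw [overlap, Matrix.conjTranspose_kronecker, ← Matrix.mul_kronecker_mul, hU,
    Matrix.kronecker_apply, Matrix.one_apply]
  split_ifs <;> simp [overlap]

/-- Both products share the eigenbasis of `Ψ`, so only pairs with equal first index overlap, and
there `log r i` cancels. -/
theorem relEntropy_trace_kronecker (hΨ : Ψ.PosSemidef) (hσ : σ.PosSemidef) (hτ : τ.PosSemidef)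
    (h : supp σ ≤ supp τ) :
    ((Ψ ⊗ₖ σ) * (mlog (Ψ ⊗ₖ σ) - mlog (Ψ ⊗ₖ τ))).trace.re =
      Ψ.trace.re * (σ * (mlog σ - mlog τ)).trace.re := by
  obtain ⟨U, r, hU, hr⟩ := exists_diagonalizes_nonneg hΨ
  obtain ⟨V, p, hV, hp⟩ := exists_diagonalizes_nonneg hσ
  obtain ⟨W, t, hW, ht⟩ := exists_diagonalizes_nonneg hτ
  rw [(hU.kronecker hV).trace_relEntropy (hU.kronecker hW), hU.trace_re,
    hV.trace_relEntropy hW, Fintype.sum_prod_type, Finset.sum_mul]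
  refine Finset.sum_congr rfl fun i _ => ?_
  rw [Finset.mul_sum]
  refine Finset.sum_congr rfl fun j _ => ?_
  rw [Fintype.sum_prod_type, Finset.sum_eq_single i, Finset.mul_sum]
  · refine Finset.sum_congr rfl fun l _ => ?_
    rw [overlap_kronecker hU.left, if_pos rfl]
    by_cases hc : overlap V W j l * p j = 0
    · rcases mul_eq_zero.1 hc with h0 | h0 <;> simp [h0]
    have hpj : p j ≠ 0 := right_ne_zero_of_mul hc
    have htl : t l ≠ 0 := fun h0 => hc (hV.mul_overlap_eq_zero hW h h0)
    by_cases hri : r i = 0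
    · simp [hri]
    rw [Real.log_mul hri hpj, Real.log_mul hri htl]
    ring
  · intro k _ hk
    simp [overlap_kronecker hU.left, Ne.symm hk]
  · simp

theorem exists_eq_mul_of_supp_le (h : supp σ ≤ supp τ) : ∃ D, σ = τ * D := by
  have h1 : ∀ j, ∃ w : n → ℂ, τ *ᵥ w = σ *ᵥ Pi.single j 1 := fun j =>
    mem_supp_iff.1 (h (mem_supp_iff (v := WithLp.toLp 2 (σ *ᵥ Pi.single j 1)).2 ⟨_, rfl⟩))
  choose w hw using h1
  refine ⟨Matrix.of fun i j => w j i, ?_⟩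
  apply Matrix.ext_of_mulVec_single
  intro j
  rw [← hw j, ← Matrix.mulVec_mulVec, Matrix.mulVec_single_one]
  rfl

/-- The inclusion of supports gives `σ = Dᴴ * τ`, a factorization that survives tensoring with `Ψ`.
-/
theorem supp_kronecker_le (hΨ : Ψ.IsHermitian) (hσ : σ.IsHermitian) (hτ : τ.IsHermitian)
    (h : supp σ ≤ supp τ) : supp (Ψ ⊗ₖ σ) ≤ supp (Ψ ⊗ₖ τ) := by
  obtain ⟨D, hD⟩ := exists_eq_mul_of_supp_le h
  have hD' : σ = Dᴴ * τ := by
    have := congrArg Matrix.conjTranspose hD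
    rwa [Matrix.conjTranspose_mul, hσ.eq, hτ.eq] at this
  rw [supp_le_iff_ker (by rw [Matrix.IsHermitian, Matrix.conjTranspose_kronecker, hΨ.eq, hσ.eq])
    (by rw [Matrix.IsHermitian, Matrix.conjTranspose_kronecker, hΨ.eq, hτ.eq])]
  intro v hv
  have : Ψ ⊗ₖ σ = (1 ⊗ₖ Dᴴ) * (Ψ ⊗ₖ τ) := by
    rw [← Matrix.mul_kronecker_mul, one_mul, ← hD']
  rw [this, ← Matrix.mulVec_mulVec, hv, Matrix.mulVec_zero]

/-- A vector in the kernel of a sum of positive semidefinite matrices lies in the kernel of each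
summand. -/
theorem supp_sum_le {ι : Type*} [Fintype ι] {a b : ι → Matrix n n ℂ}
    (ha : ∀ x, (a x).PosSemidef) (hb : ∀ x, (b x).PosSemidef)
    (h : ∀ x, supp (a x) ≤ supp (b x)) : supp (∑ x, a x) ≤ supp (∑ x, b x) := by
  rw [supp_le_iff_ker (Matrix.posSemidef_sum Finset.univ fun x _ => ha x).1
    (Matrix.posSemidef_sum Finset.univ fun x _ => hb x).1]
  intro v hv
  have h0 : ∑ x, star v ⬝ᵥ (b x *ᵥ v) = 0 := by
    rw [← dotProduct_sum, ← Matrix.sum_mulVec, hv, dotProduct_zero]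
  rw [Finset.sum_eq_zero_iff_of_nonneg fun x _ => (hb x).dotProduct_mulVec_nonneg v] at h0
  rw [Matrix.sum_mulVec]
  refine Finset.sum_eq_zero fun x hx => ?_
  exact (supp_le_iff_ker (ha x).1 (hb x).1).1 (h x) v
    (((hb x).dotProduct_mulVec_zero_iff v).1 (h0 x hx))

end Kronecker

/-! ### Reduction of arbitrary channel inputs to canonical purifications -/

section Channel

variable {X B : Type*} [Fintype X] [DecidableEq X] [Fintype B] [DecidableEq B]
  {ρ : X → Matrix B B ℂ} {Ψ : Matrix (X × X) (X × X) ℂ}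

/-- The block `⟨x|Ψ|x⟩` of a bipartite matrix, with `x` in the second system. -/
def sndBlock (Ψ : Matrix (X × X) (X × X) ℂ) (x : X) : Matrix X X ℂ :=
  Ψ.submatrix (fun i => (i, x)) fun i => (i, x)

theorem sndBlock_posSemidef (hΨ : Ψ.PosSemidef) (x : X) : (sndBlock Ψ x).PosSemidef :=
  hΨ.submatrix _

theorem sum_trace_sndBlock (Ψ : Matrix (X × X) (X × X) ℂ) :
    ∑ x, (sndBlock Ψ x).trace = Ψ.trace := by
  simp only [Matrix.trace, sndBlock, Matrix.diag_apply, Matrix.submatrix_apply,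
    Fintype.sum_prod_type]
  exact Finset.sum_comm

theorem idTensor_cqChannel (ρ : X → Matrix B B ℂ) (Ψ : Matrix (X × X) (X × X) ℂ) :
    idTensor X (cqChannel ρ) Ψ = ∑ x, sndBlock Ψ x ⊗ₖ ρ x := by
  ext ⟨x, i⟩ ⟨y, j⟩
  simp [idTensor, cqChannel, sndBlock, Matrix.sum_apply]

theorem marginalFst_idTensor (hρ : ∀ x, IsDensity (ρ x)) (Ψ : Matrix (X × X) (X × X) ℂ) :
    marginalFst (idTensor X (cqChannel ρ) Ψ) = ∑ x, sndBlock Ψ x := by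
  rw [idTensor_cqChannel]
  ext i j
  simp only [marginalFst, Matrix.of_apply, Matrix.sum_apply, Matrix.kronecker_apply]
  rw [Finset.sum_comm]
  refine Finset.sum_congr rfl fun x _ => ?_
  rw [← Finset.mul_sum]
  have := (hρ x).2
  rw [Matrix.trace] at this
  simp only [Matrix.diag_apply] at this
  rw [this, mul_one]

/-- Among the input states with given weights of the classical symbols, the canonical
purification maximizes the umlaut information of the output. -/
theorem umlaut_idTensor_le (hρ : ∀ x, IsDensity (ρ x)) (hΨ : IsDensity Ψ) :
    umlaut (idTensor X (cqChannel ρ) Ψ) ≤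
      umlaut (outputState (cqChannel ρ) fun x => (sndBlock Ψ x).trace.re) := by
  have hP : ∀ x, 0 ≤ (sndBlock Ψ x).trace.re := fun x =>
    (Complex.nonneg_iff.1 (sndBlock_posSemidef hΨ.1 x).trace_nonneg).1
  -- The two minima are compared with the same `σ` on both sides.
  refine le_iInf₂ fun σ hσ => iInf₂_le_of_le σ hσ ?_
  by_cases h : ∀ x, (sndBlock Ψ x).trace.re ≠ 0 → supp σ ≤ supp (ρ x)
  swap
  · rw [relEntropy_output_eq_top hρ hP hσ h]
    exact le_top
  -- Symbols of weight zero have a vanishing block, so they impose no support condition.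
  have hzero : ∀ x, (sndBlock Ψ x).trace.re = 0 → sndBlock Ψ x = 0 := fun x hx => by
    have h1 := (Complex.nonneg_iff.1 (sndBlock_posSemidef hΨ.1 x).trace_nonneg).2
    rw [← (sndBlock_posSemidef hΨ.1 x).trace_eq_zero_iff]
    exact Complex.ext hx h1.symm
  have ha : ∀ x, (sndBlock Ψ x ⊗ₖ σ).PosSemidef := fun x =>
    (sndBlock_posSemidef hΨ.1 x).kronecker hσ.1
  have hb : ∀ x, (sndBlock Ψ x ⊗ₖ ρ x).PosSemidef := fun x =>
    (sndBlock_posSemidef hΨ.1 x).kronecker (hρ x).1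
  have hab : ∀ x, supp (sndBlock Ψ x ⊗ₖ σ) ≤ supp (sndBlock Ψ x ⊗ₖ ρ x) := fun x => by
    by_cases hx : (sndBlock Ψ x).trace.re = 0
    · rw [hzero x hx, Matrix.zero_kronecker, Matrix.zero_kronecker]
    · exact supp_kronecker_le (sndBlock_posSemidef hΨ.1 x).1 hσ.1.1 (hρ x).1.1 (h x hx)
  have hsupp := supp_sum_le ha hb hab
  have hsum : (∑ x, sndBlock Ψ x) ⊗ₖ σ = ∑ x, sndBlock Ψ x ⊗ₖ σ := by
    ext ⟨x, i⟩ ⟨y, j⟩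
    simp [Matrix.sum_apply, Finset.sum_mul]
  rw [relEntropy_output hρ hP hσ h, marginalFst_idTensor hρ, idTensor_cqChannel, hsum, relEntropy,
    if_pos hsupp, EReal.coe_le_coe_iff]
  refine (relEntropy_trace_sum_le ha hb hab hsupp).trans_eq
    (Finset.sum_congr rfl fun x _ => ?_)
  by_cases hx : (sndBlock Ψ x).trace.re = 0
  · rw [hx, hzero x hx, Matrix.zero_kronecker]; simp
  · exact relEntropy_trace_kronecker (sndBlock_posSemidef hΨ.1 x) hσ.1 (hρ x).1 (h x hx)

theorem isDensity_purification {P : X → ℝ} (hP : P ∈ stdSimplex ℝ X) :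
    IsDensity ((Matrix.diagonal (fun x => ((√(P x) : ℝ) : ℂ)) ⊗ₖ (1 : Matrix X X ℂ)) *
      maxEntangled X * (Matrix.diagonal (fun x => ((√(P x) : ℝ) : ℂ)) ⊗ₖ (1 : Matrix X X ℂ))) := by
  have h : (Matrix.diagonal (fun x => ((√(P x) : ℝ) : ℂ)) ⊗ₖ (1 : Matrix X X ℂ)) =
      Matrix.diagonal fun p : X × X => ((√(P p.1) : ℝ) : ℂ) := by
    rw [← Matrix.diagonal_one, Matrix.diagonal_kronecker_diagonal]
    simp
  rw [h]
  constructor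
  · have hΦ : (maxEntangled X).PosSemidef := by
      have : maxEntangled X = Matrix.vecMulVec (fun p : X × X => if p.1 = p.2 then (1 : ℂ) else 0)
          (star fun p : X × X => if p.1 = p.2 then (1 : ℂ) else 0) := by
        ext p s
        simp only [maxEntangled, Matrix.of_apply, Matrix.vecMulVec_apply, Pi.star_apply]
        by_cases h1 : p.1 = p.2 <;> by_cases h2 : s.1 = s.2 <;> simp [h1, h2]
      rw [this]
      exact Matrix.posSemidef_vecMulVec_self_star _
    have hD : (Matrix.diagonal fun p : X × X => ((√(P p.1) : ℝ) : ℂ))ᴴ =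
        Matrix.diagonal fun p : X × X => ((√(P p.1) : ℝ) : ℂ) := by
      rw [Matrix.diagonal_conjTranspose]
      congr 1
      ext p
      simp
    have := hΦ.mul_mul_conjTranspose_same (Matrix.diagonal fun p : X × X => ((√(P p.1) : ℝ) : ℂ))
    rwa [hD] at this
  · simp only [Matrix.trace, Matrix.diag_apply, Matrix.mul_diagonal, Matrix.diagonal_mul,
      maxEntangled, Matrix.of_apply, and_self, Fintype.sum_prod_type]
    have : ∀ x y : X, ((√(P x) : ℝ) : ℂ) * (if x = y then 1 else 0) * ((√(P x) : ℝ) : ℂ) =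
        if x = y then (P x : ℂ) else 0 := fun x y => by
      split_ifs
      · rw [mul_one, ← Complex.ofReal_mul, Real.mul_self_sqrt (hP.1 x)]
      · simp
    simp only [this, Finset.sum_ite_eq, Finset.mem_univ, if_true]
    exact_mod_cast hP.2

theorem umlaut_outputState_le_channelUmlaut {P : X → ℝ} (hP : P ∈ stdSimplex ℝ X) :
    umlaut (outputState (cqChannel ρ) P) ≤ channelUmlaut (cqChannel ρ) :=
  le_iSup₂_of_le _ (isDensity_purification hP) le_rfl

theorem channelUmlaut_eq_iSup (hρ : ∀ x, IsDensity (ρ x)) :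
    channelUmlaut (cqChannel ρ) =
      ⨆ P ∈ stdSimplex ℝ X, umlaut (outputState (cqChannel ρ) P) := by
  refine le_antisymm (iSup₂_le fun Ψ hΨ => ?_)
    (iSup₂_le fun P hP => umlaut_outputState_le_channelUmlaut hP)
  refine le_iSup₂_of_le (fun x => (sndBlock Ψ x).trace.re) ⟨fun x => ?_, ?_⟩
    (umlaut_idTensor_le hρ hΨ)
  · exact (Complex.nonneg_iff.1 (sndBlock_posSemidef hΨ.1 x).trace_nonneg).1
  · rw [← Complex.re_sum, sum_trace_sndBlock, hΨ.2, Complex.one_re]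

end Channel

end Umlaut

/-! ### The three claims combined -/

theorem mainTheorem11 {X B : Type*} [Fintype X] [DecidableEq X] [Fintype B] [DecidableEq B]
    (ρ : X → Matrix B B ℂ) (hρ : ∀ x, Umlaut.IsDensity (ρ x)) :
    (∀ (k : ℕ) (q : Fin k → ℝ), 1 ≤ k → ∑ i, q i = 1 →
      (∀ P ∈ stdSimplex ℝ X,
        Umlaut.lowerUmlaut ρ P q ≤ Umlaut.umlaut (Umlaut.outputState (Umlaut.cqChannel ρ) P)) ∧
      (⨆ P ∈ stdSimplex ℝ X, Umlaut.lowerUmlaut ρ P q)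
        ≤ Umlaut.channelUmlaut (Umlaut.cqChannel ρ)) ∧
    ((∀ x y, Umlaut.supp (ρ x) = Umlaut.supp (ρ y)) →
      (∀ P ∈ stdSimplex ℝ X,
        Tendsto (fun k : ℕ => Umlaut.lowerUmlaut ρ P (Umlaut.uniformWeight k)) atTop
          (𝓝 (Umlaut.umlaut (Umlaut.outputState (Umlaut.cqChannel ρ) P)))) ∧
      Umlaut.channelUmlaut (Umlaut.cqChannel ρ) =
        (⨆ P ∈ stdSimplex ℝ X,
          limUnder atTop (fun k : ℕ => Umlaut.lowerUmlaut ρ P (Umlaut.uniformWeight k))) ∧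
      (∀ P ∈ stdSimplex ℝ X, ∃ u : ℝ,
        Umlaut.umlaut (Umlaut.outputState (Umlaut.cqChannel ρ) P) = (u : EReal) ∧
        ∀ k : ℕ, 1 ≤ k → ∃ l : ℝ,
          Umlaut.lowerUmlaut ρ P (Umlaut.uniformWeight k) = (l : EReal) ∧
          u - l ≤ Umlaut.rateBound k u (Umlaut.lamFin ρ P) (Umlaut.pMin P))) := by
  refine ⟨fun k q _ hq => ⟨fun P hP => Umlaut.lowerUmlaut_le_umlaut hρ hP hq, ?_⟩, fun hs =>
    ⟨fun P hP => Umlaut.tendsto_lowerUmlaut hρ hs hP, ?_, fun P hP => ?_⟩⟩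
  · exact iSup₂_le fun P hP => (Umlaut.lowerUmlaut_le_umlaut hρ hP hq).trans
      (Umlaut.umlaut_outputState_le_channelUmlaut hP)
  · rw [Umlaut.channelUmlaut_eq_iSup hρ]
    -- `limUnder` is the genuine limit here, since convergence is already established for each `P`.
    exact iSup_congr fun P => iSup_congr fun hP =>
      (Umlaut.tendsto_lowerUmlaut hρ hs hP).limUnder_eq.symm
  · obtain ⟨u, hu0, hu⟩ := Umlaut.exists_umlaut_eq_coe hρ hs hP
    refine ⟨u, hu, fun k hk => ?_⟩
    obtain ⟨l, hl, -, hc⟩ := Umlaut.exists_lowerUmlaut_eq_coe hρ hs hP hu0 hu hk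
    exact ⟨l, hl, Umlaut.le_rateBound hk hu0 (Umlaut.lamFin_nonneg hρ hs hP)
      (Umlaut.pMin_pos hP) hc⟩
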